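/- Let $\mathbb{K}$ be a commutative ring. A dg-module is an $\mathbb{N}$-graded $\mathbb{K}$-module with a differential of degree $-1$; a dg-$\Sigma_*$-module $M$ is a sequence of dg-modules $M(n)$, $n\in\mathbb{N}$, with actions of the symmetric groups $\Sigma_n$; a morphism of dg-$\Sigma_*$-modules is a quasi-isomorphism if it induces an isomorphism in homology in each arity $n$. The composition product is $(M\circ N)(n)=\bigoplus_{r\ge 0}\bigl(\bigoplus_{J_1\amalg\cdots\amalg J_r=\{1,\ldots,n\}}M(r)\otimes N(J_1)\otimes\cdots\otimes N(J_r)\bigr)_{\Sigma_r}$. A dg-operad $P$ is connected if $P(0)=0$ and $P(1)=\mathbb{K}\,1$ (free on the operad unit). The indecomposable quotient of a left module $R$ over a connected dg-operad $P$ is the dg-$\Sigma_*$-module $I\circ_P R$, that is, the quotient of $R$ by the dg-$\Sigma_*$-submodule generated by the composites $p(y_1,\ldots,y_r)$ with $p\in P(r)$, $r\neq 1$. A left $P$-module $R$ is quasi-free, written $R=P\circ\bar R$, if for some dg-$\Sigma_*$-module $\bar R$ it is the free graded left $P$-module $P\circ\bar R$ equipped with a differential $\delta+d_\theta$ which satisfies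 the derivation relation with respect to the action of $P$, where $\delta$ is the canonical differential of $P\circ\bar R$ and where the composite $\bar R\subset P\circ\bar R\xrightarrow{d_\theta}P\circ\bar R\to\bar R$ vanishes; then $\bar R$ is identified with the indecomposable quotient of $R$. \textbf{Theorem.} Let $\phi:P\to P'$ be a morphism of connected dg-operads. Let $R=P\circ\bar R$ be a quasi-free left $P$-module and $R'=P'\circ\bar R'$ a quasi-free left $P'$-module, with $\bar R(0)=\bar R'(0)=0$, and let $\psi:R\to R'$ be a morphism of left $P$-modules, where $R'$ is a left $P$-module by restriction of structure along $\phi$. Assume that the $\mathbb{K}$-modules $\bar R(n)$ and $\bar R'(n)$ are projective for all $n$ (which is automatic if $\mathbb{K}$ is a field). Let $\bar\psi:\bar R\to\bar R'$ be the morphism of dg-$\Sigma_*$-modules induced by $\psi$ on indecomposable quotients. (a) If $\phi:P\to P'$ and $\bar\psi:\bar R\to\bar R'$ are quasi-isomorphisms, then so is $\psi:R\to R'$. (b) If $\phi:P\to P'$ and $\psi:R\to R'$ are quasi-isomorphisms, then so is $\bar\psi:\bar R\to\bar R'$. (c) Assume in addition that $\bar R(1)=\bar R'(1)=\mathbb{K}$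 (free of rank one, concentrated in degree $0$). If $\psi:R\to R'$ and $\bar\psi:\bar R\to\bar R'$ are quasi-isomorphisms, then so is $\phi:P\to P'$. -/

import Mathlib

open scoped DirectSum TensorProduct

universe u v

namespace OperadicModules

variable {K : Type u} [CommRing K]

/-! ### Differential graded modules -/

/-- A dg-module: an `ℕ`-graded `K`-module `V = ⨁ V_d` (the grading is internal, `gr d = V_d`) with
a differential of degree `-1`. -/
structure DGMod (K : Type u) [CommRing K] where
  carrier : Type v
  [addCommGroup : AddCommGroup carrier]
  [module : Module K carrier]
  gr : ℕ → Submodule K carrier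
  isInternal : DirectSum.IsInternal gr
  d : carrier →ₗ[K] carrier
  d_mem : ∀ (k : ℕ) (x : carrier), x ∈ gr (k + 1) → d x ∈ gr k
  d_zero : ∀ x ∈ gr 0, d x = 0
  d_d : ∀ x, d (d x) = 0

namespace DGMod

instance : CoeSort (DGMod.{u, v} K) (Type v) := ⟨DGMod.carrier⟩

attribute [instance] DGMod.addCommGroup DGMod.module

/-- A morphism of dg-modules: homogeneous of degree `0` and commuting with differentials. -/
structure Hom (V W : DGMod.{u, v} K) where
  toLin : V →ₗ[K] W
  map_mem : ∀ (k : ℕ) (x : V), x ∈ V.gr k → toLin x ∈ W.gr k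
  map_d : ∀ x, toLin (V.d x) = W.d (toLin x)

instance (V W : DGMod.{u, v} K) : CoeFun (Hom V W) (fun _ => V → W) := ⟨fun f => f.toLin⟩

/-- The total homology `H_*(V) = ker d / im d` (the direct sum of the modules `H_k(V)`). -/
abbrev Homology (V : DGMod.{u, v} K) : Type v :=
  LinearMap.ker V.d ⧸ (LinearMap.range V.d).submoduleOf (LinearMap.ker V.d)

/-- The map `f_* : H_*(V) → H_*(W)` induced by a morphism. -/
def Hom.homologyMap {V W : DGMod.{u, v} K} (f : Hom V W) : V.Homology →ₗ[K] W.Homology :=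
  Submodule.mapQ _ _
    (f.toLin.restrict (p := LinearMap.ker V.d) (q := LinearMap.ker W.d) (fun x hx => by
      rw [LinearMap.mem_ker] at hx ⊢
      rw [← f.map_d, hx, map_zero]))
    (by
      rintro ⟨x, hx⟩ ⟨y, hy⟩
      refine ⟨f y, ?_⟩
      rw [← f.map_d]
      exact congrArg f.toLin hy)

def Hom.IsQuasiIso {V W : DGMod.{u, v} K} (f : Hom V W) : Prop :=
  Function.Bijective f.homologyMap

/-- `V = K`: the dg-module `V` is free of rank one over `K`, on a generator of degree `0`. -/
def IsGroundRing (V : DGMod.{u, v} K) : Prop :=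
  ∃ g ∈ V.gr 0, Function.Bijective (fun c : K => c • g)

end DGMod

/-! ### Symmetric modules -/

/-- A dg-`Σ_*`-module: a sequence of dg-modules `M(n)`, with an action of the symmetric group
`Σ_n` on `M(n)` by morphisms of dg-modules.  The action is written as a functor on the groupoid of
the sets `Fin n` and their bijections; a bijection `Fin m ≃ Fin n` exists only for `m = n`, so that
this amounts to a left action of `Equiv.Perm (Fin n)` on `M(n)` for each `n`. -/
structure SymMod (K : Type u) [CommRing K] where
  obj : ℕ → DGMod.{u, v} K
  map : ∀ {m n : ℕ}, (Fin m ≃ Fin n) → DGMod.Hom (obj m) (obj n)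
  map_refl : ∀ (n : ℕ) (x : obj n), map (Equiv.refl (Fin n)) x = x
  map_trans : ∀ {l m n : ℕ} (e : Fin l ≃ Fin m) (f : Fin m ≃ Fin n) (x : obj l),
    map (e.trans f) x = map f (map e x)

namespace SymMod

instance : CoeFun (SymMod.{u, v} K) (fun _ => ℕ → DGMod.{u, v} K) := ⟨SymMod.obj⟩

/-- A morphism of dg-`Σ_*`-modules. -/
structure Hom (M N : SymMod.{u, v} K) where
  app : ∀ n, DGMod.Hom (M n) (N n)
  naturality : ∀ {m n : ℕ} (e : Fin m ≃ Fin n) (x : M m),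
    app n (M.map e x) = N.map e (app m x)

/-- A morphism of dg-`Σ_*`-modules is a quasi-isomorphism if it is one in each arity. -/
def Hom.IsQuasiIso {M N : SymMod.{u, v} K} (f : Hom M N) : Prop :=
  ∀ n, (f.app n).IsQuasiIso

/-- `M` is connected: `M(0) = 0`. -/
def IsConnected (M : SymMod.{u, v} K) : Prop := Subsingleton (M 0)

/-- `M` is projective as a `K`-module. -/
def IsProjective (M : SymMod.{u, v} K) : Prop := ∀ n, Module.Projective K (M n)

end SymMod

/-! ### Signs and permutations -/

/-- The Koszul sign of the reordering `y_1 ⊗ ⋯ ⊗ y_s ↦ y_{w(1)} ⊗ ⋯ ⊗ y_{w(r)}`, for elements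
`y_j` of degree `e j`. -/
def koszulSign (K : Type u) [CommRing K] {r s : ℕ} (w : Fin r ≃ Fin s) (e : Fin s → ℕ) : K :=
  ∏ i : Fin r, ∏ j : Fin r, if i < j ∧ w j < w i then (-1 : K) ^ (e (w i) * e (w j)) else 1

/-- The bijection of the blocks `u_1 ⊔ ⋯ ⊔ u_r`. -/
def sumEquiv {r : ℕ} {m n : Fin r → ℕ} (u : ∀ i, Fin (m i) ≃ Fin (n i)) :
    Fin (∑ i, m i) ≃ Fin (∑ i, n i) :=
  finSigmaFinEquiv.symm.trans ((Equiv.sigmaCongrRight u).trans finSigmaFinEquiv)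

/-- The block permutation determined by `w`: it moves the `i`-th block, of size `n (w i)`, to the
`w i`-th block. -/
def blockEquiv {r s : ℕ} (w : Fin r ≃ Fin s) (n : Fin s → ℕ) :
    Fin (∑ i, n (w i)) ≃ Fin (∑ j, n j) :=
  finSigmaFinEquiv.symm.trans
    ((Equiv.sigmaCongrLeft (β := fun j => Fin (n j)) w).trans finSigmaFinEquiv)

theorem sum_sum_finSigma {r : ℕ} (n : Fin r → ℕ) (m : Fin (∑ i, n i) → ℕ) :
    ∑ i, ∑ a, m (finSigmaFinEquiv ⟨i, a⟩) = ∑ k, m k := by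
  rw [← Equiv.sum_comp finSigmaFinEquiv m, Fintype.sum_sigma]

/-! ### Operads and their left modules -/

/-- A morphism of dg-`Σ_*`-modules `A ∘ B → B`, given by composition products
`A(r) ⊗ B(n_1) ⊗ ⋯ ⊗ B(n_r) → B(n_1 + ⋯ + n_r)`, `(p, y_1, …, y_r) ↦ p(y_1, …, y_r)`, which
preserve degrees, satisfy the derivation relation, and are equivariant (with the signs of the
symmetry isomorphism of dg-modules). -/
structure Action (A B : SymMod.{u, v} K) where
  comp : ∀ {r : ℕ} (n : Fin r → ℕ),
    A r →ₗ[K] MultilinearMap K (fun i => (B (n i) : Type v)) (B (∑ i, n i))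
  comp_mem : ∀ {r : ℕ} (n : Fin r → ℕ) (a : ℕ) (e : Fin r → ℕ) (p : A r) (y : ∀ i, B (n i)),
    p ∈ (A r).gr a → (∀ i, y i ∈ (B (n i)).gr (e i)) →
    comp n p y ∈ (B (∑ i, n i)).gr (a + ∑ i, e i)
  d_comp : ∀ {r : ℕ} (n : Fin r → ℕ) (a : ℕ) (e : Fin r → ℕ) (p : A r) (y : ∀ i, B (n i)),
    p ∈ (A r).gr a → (∀ i, y i ∈ (B (n i)).gr (e i)) →
    (B (∑ i, n i)).d (comp n p y) = comp n ((A r).d p) y +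
      ∑ i, (-1 : K) ^ (a + ∑ j ∈ Finset.Iio i, e j) •
        comp n p (Function.update y i ((B (n i)).d (y i)))
  comp_map_inner : ∀ {r : ℕ} (m n : Fin r → ℕ) (u : ∀ i, Fin (m i) ≃ Fin (n i)) (p : A r)
    (y : ∀ i, B (m i)),
    comp n p (fun i => B.map (u i) (y i)) = B.map (sumEquiv u) (comp m p y)
  comp_map_outer : ∀ {r s : ℕ} (w : Fin r ≃ Fin s) (n : Fin s → ℕ) (e : Fin s → ℕ) (p : A r)
    (y : ∀ j, B (n j)), (∀ j, y j ∈ (B (n j)).gr (e j)) →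
    comp n (A.map w p) y =
      koszulSign K w e • B.map (blockEquiv w n) (comp (fun i => n (w i)) p (fun i => y (w i)))

/-- The associativity relation
`p(q_1, …, q_r)(y_{11}, …, y_{r n_r}) = ± p(q_1(y_{11}, …, y_{1 n_1}), …, q_r(y_{r1}, …, y_{r n_r}))`,
where the sign is produced by the commutation of `q_i` with the `y_{j a}`, `j < i`. -/
def Action.IsAssociative {A B : SymMod.{u, v} K} (μ : Action A A) (ρ : Action A B) : Prop :=
  ∀ {r : ℕ} (n : Fin r → ℕ) (m : Fin (∑ i, n i) → ℕ) (b : Fin r → ℕ) (e : Fin (∑ i, n i) → ℕ)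
    (p : A r) (q : ∀ i, A (n i)) (y : ∀ k, B (m k)),
    (∀ i, q i ∈ (A (n i)).gr (b i)) → (∀ k, y k ∈ (B (m k)).gr (e k)) →
    ρ.comp m (μ.comp n p q) y =
      (-1 : K) ^ (∑ i, ∑ j ∈ Finset.Iio i, b i * ∑ a, e (finSigmaFinEquiv ⟨j, a⟩)) •
        B.map (finCongr (sum_sum_finSigma n m))
          (ρ.comp (fun i => ∑ a, m (finSigmaFinEquiv ⟨i, a⟩)) p
            (fun i => ρ.comp (fun a => m (finSigmaFinEquiv ⟨i, a⟩)) (q i)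
              (fun a => y (finSigmaFinEquiv ⟨i, a⟩))))

/-- The unit relation `1(y) = y`. -/
def Action.IsUnital {A B : SymMod.{u, v} K} (ρ : Action A B) (one : A 1) : Prop :=
  ∀ (n : ℕ) (y : B n),
    ρ.comp (fun _ : Fin 1 => n) one (fun _ => y) =
      B.map (finCongr (Fin.sum_univ_one (fun _ => n)).symm) y

/-- A dg-operad. -/
structure Operad (K : Type u) [CommRing K] extends SymMod.{u, v} K where
  mul : Action toSymMod toSymMod
  one : obj 1
  one_mem : one ∈ (obj 1).gr 0
  assoc : mul.IsAssociative mul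
  one_mul : mul.IsUnital one
  mul_one : ∀ (r : ℕ) (p : obj r),
    mul.comp (fun _ : Fin r => 1) p (fun _ => one) = map (finCongr (by simp)) p

namespace Operad

/-- `P` is connected: `P(0) = 0` and `P(1) = K 1` (free on the operad unit). -/
def IsConnected (P : Operad.{u, v} K) : Prop :=
  Subsingleton (P.obj 0) ∧ Function.Bijective (fun c : K => c • P.one)

/-- A morphism of dg-operads. -/
structure Hom (P Q : Operad.{u, v} K) extends SymMod.Hom P.toSymMod Q.toSymMod where
  map_one : app 1 P.one = Q.one
  map_mul : ∀ {r : ℕ} (n : Fin r → ℕ) (p : P.obj r) (q : ∀ i, P.obj (n i)),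
    app _ (P.mul.comp n p q) = Q.mul.comp n (app r p) (fun i => app (n i) (q i))

end Operad

/-- A (dg-)left module over a dg-operad `P`. -/
structure LeftModule (P : Operad.{u, v} K) extends SymMod.{u, v} K where
  act : Action P.toSymMod toSymMod
  assoc : P.mul.IsAssociative act
  one_act : act.IsUnital P.one

namespace LeftModule

variable {P P' : Operad.{u, v} K}

/-- A morphism of left `P`-modules. -/
structure Hom (R S : LeftModule P) extends SymMod.Hom R.toSymMod S.toSymMod where
  map_act : ∀ {r : ℕ} (n : Fin r → ℕ) (p : P.obj r) (y : ∀ i, R.obj (n i)),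
    app _ (R.act.comp n p y) = S.act.comp n p (fun i => app (n i) (y i))

/-- Restriction of structure: a left `P'`-module is a left `P`-module through `φ : P → P'`. -/
def restrict (φ : Operad.Hom P P') (R : LeftModule P') : LeftModule P where
  toSymMod := R.toSymMod
  act :=
    { comp := fun {r} n => (R.act.comp n).comp (φ.app r).toLin
      comp_mem := fun n a e p y hp hy =>
        R.act.comp_mem n a e _ y ((φ.app _).map_mem a p hp) hy
      d_comp := fun n a e p y hp hy => by
        simp only [LinearMap.comp_apply]
        rw [R.act.d_comp n a e _ y ((φ.app _).map_mem a p hp) hy, (φ.app _).map_d]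
      comp_map_inner := fun m n u p y => R.act.comp_map_inner m n u _ y
      comp_map_outer := fun w n e p y hy => by
        simp only [LinearMap.comp_apply]
        rw [φ.naturality w p]
        exact R.act.comp_map_outer w n e _ y hy }
  assoc := by
    intro r n m b e p q y hq hy
    simp only [LinearMap.comp_apply]
    rw [φ.map_mul]
    exact R.assoc n m b e _ _ y (fun i => (φ.app _).map_mem _ _ (hq i)) hy
  one_act := by
    intro n y
    simp only [LinearMap.comp_apply]
    rw [φ.map_one]
    exact R.one_act n y

/-! ### The indecomposable quotient -/

/-- The decomposable elements of `R(n)`: the submodule spanned by the composites `p(y_1, …, y_r)`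
with `p` in the augmentation ideal of `P`, and by their images under permutations.  For a connected
operad the augmentation ideal consists of the modules `P(r)` with `r ≠ 1`.  By multilinearity it is
enough to take homogeneous elements. -/
def decomposables (R : LeftModule P) (n : ℕ) : Submodule K (R.obj n) :=
  Submodule.span K {z | ∃ (r : ℕ) (k : Fin r → ℕ) (σ : Fin (∑ i, k i) ≃ Fin n) (a : ℕ)
    (e : Fin r → ℕ) (p : P.obj r) (y : ∀ i, R.obj (k i)),
    r ≠ 1 ∧ p ∈ (P.obj r).gr a ∧ (∀ i, y i ∈ (R.obj (k i)).gr (e i)) ∧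
      z = R.map σ (R.act.comp k p y)}

theorem mem_decomposables {R : LeftModule P} {n r : ℕ} {k : Fin r → ℕ}
    (σ : Fin (∑ i, k i) ≃ Fin n) {a : ℕ} {e : Fin r → ℕ} {p : P.obj r} {y : ∀ i, R.obj (k i)}
    (hr : r ≠ 1) (hp : p ∈ (P.obj r).gr a) (hy : ∀ i, y i ∈ (R.obj (k i)).gr (e i)) :
    R.map σ (R.act.comp k p y) ∈ R.decomposables n :=
  Submodule.subset_span ⟨r, k, σ, a, e, p, y, hr, hp, hy, rfl⟩

theorem exists_d_mem (V : DGMod.{u, v} K) {k : ℕ} {x : V} (hx : x ∈ V.gr k) :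
    ∃ l, V.d x ∈ V.gr l := by
  cases k with
  | zero => exact ⟨0, by rw [V.d_zero x hx]; exact zero_mem _⟩
  | succ k => exact ⟨k, V.d_mem k x hx⟩

theorem d_decomposables (R : LeftModule P) (n : ℕ) :
    R.decomposables n ≤ (R.decomposables n).comap (R.obj n).d := by
  refine Submodule.span_le.2 ?_
  rintro _ ⟨r, k, σ, a, e, p, y, hr, hp, hy, rfl⟩
  change (R.obj n).d _ ∈ R.decomposables n
  rw [← (R.map σ).map_d, R.act.d_comp k a e p y hp hy, map_add, map_sum]
  refine add_mem ?_ (sum_mem fun i _ => ?_)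
  · obtain ⟨l, hl⟩ := exists_d_mem _ hp
    exact mem_decomposables σ hr hl hy
  · rw [map_smul]
    refine Submodule.smul_mem _ _ ?_
    obtain ⟨l, hl⟩ := exists_d_mem _ (hy i)
    refine mem_decomposables (e := Function.update e i l) σ hr hp fun j => ?_
    by_cases h : j = i
    · subst h; simpa using hl
    · simpa [Function.update_of_ne h] using hy j

theorem map_decomposables (R : LeftModule P) {m n : ℕ} (τ : Fin m ≃ Fin n) :
    R.decomposables m ≤ (R.decomposables n).comap (R.map τ).toLin := by
  refine Submodule.span_le.2 ?_
  rintro _ ⟨r, k, σ, a, e, p, y, hr, hp, hy, rfl⟩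
  change R.map τ (R.map σ _) ∈ R.decomposables n
  rw [← R.map_trans]
  exact mem_decomposables _ hr hp hy

/-- A quotient of a graded module by a submodule spanned by homogeneous elements is graded. -/
theorem isInternal_quotient (V : DGMod.{u, v} K) (s : Set V)
    (hs : ∀ x ∈ s, ∃ k, x ∈ V.gr k) :
    DirectSum.IsInternal (fun k => (V.gr k).map (Submodule.span K s).mkQ) := by
  classical
  let _ := V.isInternal.chooseDecomposition
  set D := Submodule.span K s with hD
  have hproj : ∀ (k : ℕ) (x : V), x ∈ D → (DirectSum.decompose V.gr x k : V) ∈ D := by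
    intro k x hx
    induction hx using Submodule.span_induction with
    | mem x hx =>
      obtain ⟨l, hl⟩ := hs x hx
      by_cases h : l = k
      · subst h; rw [DirectSum.decompose_of_mem_same _ hl]; exact Submodule.subset_span hx
      · rw [DirectSum.decompose_of_mem_ne _ hl h]; exact zero_mem _
    | zero => simp
    | add x y _ _ hx hy => simpa using add_mem hx hy
    | smul c x _ hx =>
      rw [DirectSum.decompose_smul]
      exact D.smul_mem c hx
  rw [DirectSum.isInternal_submodule_iff_iSupIndep_and_iSup_eq_top]
  constructor
  · rw [iSupIndep_iff_forall_dfinsupp]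
    intro k x f h
    obtain ⟨v, hv, hvx⟩ := x.2
    choose g hg hgf using fun j => (f j).2
    -- compare the degree `k` component of `v` with the one of a sum of elements of degree `≠ k`
    have hsum : ∃ z : V, D.mkQ z = (x : V ⧸ D) ∧ (DirectSum.decompose V.gr z k : V) = 0 := by
      rw [← h, DFinsupp.lsum_apply_apply, DFinsupp.sumAddHom_apply]
      refine ⟨∑ j ∈ (f.erase k).support, g j, ?_, ?_⟩
      · rw [map_sum, DFinsupp.sum]
        refine Finset.sum_congr rfl fun j hj => ?_
        have hjk : j ≠ k := by
          rintro rfl; simp at hj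
        simp [hgf, DFinsupp.erase_ne hjk]
      · rw [DirectSum.decompose_sum, DFinsupp.finsetSum_apply, AddSubmonoidClass.coe_finsetSum]
        refine Finset.sum_eq_zero fun j hj => ?_
        have hjk : j ≠ k := by
          rintro rfl; simp at hj
        exact DirectSum.decompose_of_mem_ne _ (hg j) hjk
    obtain ⟨z, hz, hz0⟩ := hsum
    have hmem : v - z ∈ D := by
      rw [← Submodule.Quotient.eq]
      exact hvx.trans hz.symm
    have := hproj k _ hmem
    rw [DirectSum.decompose_sub, DFinsupp.sub_apply, AddSubgroupClass.coe_sub, hz0, sub_zero,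
      DirectSum.decompose_of_mem_same _ hv] at this
    ext1
    rw [← hvx]
    simpa using this
  · rw [← Submodule.map_iSup, V.isInternal.submodule_iSup_eq_top, Submodule.map_top,
      Submodule.range_mkQ]

theorem homogeneous_decomposables (R : LeftModule P) (n : ℕ) :
    DirectSum.IsInternal (fun k => ((R.obj n).gr k).map (R.decomposables n).mkQ) := by
  refine isInternal_quotient _ _ ?_
  rintro _ ⟨r, k, σ, a, e, p, y, hr, hp, hy, rfl⟩
  exact ⟨_, (R.map σ).map_mem _ _ (R.act.comp_mem k a e p y hp hy)⟩

/-- The dg-module `R̄(n)`: the quotient of `R(n)` by the decomposable elements. -/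
def indecomposablesObj (R : LeftModule P) (n : ℕ) : DGMod.{u, v} K where
  carrier := R.obj n ⧸ R.decomposables n
  gr := fun k => ((R.obj n).gr k).map (R.decomposables n).mkQ
  isInternal := R.homogeneous_decomposables n
  d := (R.decomposables n).mapQ _ (R.obj n).d (R.d_decomposables n)
  d_mem := by
    rintro k _ ⟨x, hx, rfl⟩
    exact ⟨_, (R.obj n).d_mem k x hx, rfl⟩
  d_zero := by
    rintro _ ⟨x, hx, rfl⟩
    exact (congrArg (R.decomposables n).mkQ ((R.obj n).d_zero x hx)).trans (map_zero _)
  d_d := by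
    intro x
    obtain ⟨x, rfl⟩ := Submodule.mkQ_surjective _ x
    exact (congrArg (R.decomposables n).mkQ ((R.obj n).d_d x)).trans (map_zero _)

/-- The morphism of quotients induced by a morphism of dg-modules which preserves decomposable
elements. -/
def indecomposablesDesc (R : LeftModule P) (R' : LeftModule P') {m n : ℕ}
    (f : DGMod.Hom (R.obj m) (R'.obj n))
    (hf : R.decomposables m ≤ (R'.decomposables n).comap f.toLin) :
    DGMod.Hom (R.indecomposablesObj m) (R'.indecomposablesObj n) where
  toLin := (R.decomposables m).mapQ (R'.decomposables n) f.toLin hf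
  map_mem := by
    rintro k _ ⟨x, hx, rfl⟩
    exact ⟨_, f.map_mem k x hx, rfl⟩
  map_d := by
    intro x
    obtain ⟨x, rfl⟩ := Submodule.mkQ_surjective _ x
    exact congrArg (R'.decomposables n).mkQ (f.map_d x)

/-- The indecomposable quotient `R̄ = I ∘_P R` of a left module over a connected operad, with the
differential and the action of symmetric groups induced by those of `R`. -/
def indecomposables (R : LeftModule P) : SymMod.{u, v} K where
  obj := R.indecomposablesObj
  map τ := indecomposablesDesc R R (R.map τ) (R.map_decomposables τ)
  map_refl n x := by
    obtain ⟨x, rfl⟩ := Submodule.mkQ_surjective (R.decomposables n) x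
    exact congrArg (R.decomposables n).mkQ (R.map_refl n x)
  map_trans {l m n} e f x := by
    obtain ⟨x, rfl⟩ := Submodule.mkQ_surjective (R.decomposables l) x
    exact congrArg (R.decomposables n).mkQ (R.map_trans e f x)

/-- The morphism of dg-`Σ_*`-modules underlying a morphism of left `P`-modules `R → R'`, where `R'`
is a left `P'`-module. -/
def Hom.toSymHom {R : LeftModule P} {R' : LeftModule P'} {φ : Operad.Hom P P'}
    (ψ : Hom R (R'.restrict φ)) : SymMod.Hom R.toSymMod R'.toSymMod := ψ.toHom

theorem hom_decomposables {R : LeftModule P} {R' : LeftModule P'} {φ : Operad.Hom P P'}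
    (ψ : Hom R (R'.restrict φ)) (n : ℕ) :
    R.decomposables n ≤ (R'.decomposables n).comap (ψ.toSymHom.app n).toLin := by
  refine Submodule.span_le.2 ?_
  rintro _ ⟨r, k, σ, a, e, p, y, hr, hp, hy, rfl⟩
  change ψ.toSymHom.app n (R.map σ _) ∈ R'.decomposables n
  rw [ψ.toSymHom.naturality]
  have h : ψ.toSymHom.app _ (R.act.comp k p y) =
      R'.act.comp k (φ.app r p) (fun i => ψ.toSymHom.app (k i) (y i)) := ψ.map_act k p y
  rw [h]
  exact mem_decomposables (R := R') σ hr ((φ.app r).map_mem _ _ hp)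
    (fun i => (ψ.toSymHom.app _).map_mem _ _ (hy i))

/-- The morphism `ψ̄ : R̄ → R̄'` of indecomposable quotients induced by a morphism of left
`P`-modules `ψ : R → R'`, where `R'` is a left `P'`-module and `φ : P → P'`. -/
def Hom.indecomposablesMap {R : LeftModule P} {R' : LeftModule P'} {φ : Operad.Hom P P'}
    (ψ : Hom R (R'.restrict φ)) : SymMod.Hom R.indecomposables R'.indecomposables where
  app n := indecomposablesDesc R R' (ψ.toSymHom.app n) (hom_decomposables ψ n)
  naturality {m n} e x := by
    obtain ⟨x, rfl⟩ := Submodule.mkQ_surjective (R.decomposables m) x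
    exact congrArg (R'.decomposables n).mkQ (ψ.toSymHom.naturality e x)

end LeftModule

/-! ### The composition product -/

/-- The parts `J_i = f⁻¹(i)` of the ordered partition `J_1 ⊔ ⋯ ⊔ J_r = {1, …, n}` encoded by a map
`f`. -/
def part {n r : ℕ} (f : Fin n → Fin r) (i : Fin r) : Finset (Fin n) := {a | f a = i}

/-- The bijection which maps the `i`-th block increasingly onto the part `J_i`. -/
def shuffle {n r : ℕ} (f : Fin n → Fin r) : Fin (∑ i, (part f i).card) ≃ Fin n :=
  finSigmaFinEquiv.symm.trans ((Equiv.sigmaCongrRight fun i =>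
    ((part f i).orderIsoOfFin rfl).toEquiv.trans
      (Equiv.subtypeEquivRight (q := fun a => f a = i) (by simp [part]))).trans
    (Equiv.sigmaFiberEquiv f))

theorem part_comp {n r : ℕ} (w : Equiv.Perm (Fin r)) (f : Fin n → Fin r) (i : Fin r) :
    part (w ∘ f) (w i) = part f i := by
  ext; simp [part]

/-- The sum of the `M(r) ⊗ N(J_1) ⊗ ⋯ ⊗ N(J_r)` over all `r` and all ordered partitions
`J_1 ⊔ ⋯ ⊔ J_r = {1, …, n}`, where `N(J)` is identified with `N(|J|)` by the increasing bijection
`{1, …, |J|} ≃ J`. -/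
abbrev PreComposite (M N : SymMod.{u, v} K) (n : ℕ) : Type (max u v) :=
  ⨁ x : (Σ r : ℕ, (Fin n → Fin r)),
    (M x.1 ⊗[K] (⨂[K] i : Fin x.1, (N (part x.2 i).card : Type v)))

/-- The summand of index `(J_1, …, J_r)`, where `J_i = f⁻¹(i)`. -/
noncomputable def PreComposite.of (M N : SymMod.{u, v} K) {n r : ℕ} (f : Fin n → Fin r) (p : M r)
    (y : ∀ i, N (part f i).card) : PreComposite M N n :=
  letI := Classical.decEq (Σ r : ℕ, (Fin n → Fin r))
  DirectSum.lof K (Σ r : ℕ, (Fin n → Fin r))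
    (fun x => M x.1 ⊗[K] (⨂[K] i : Fin x.1, (N (part x.2 i).card : Type v)))
    ⟨r, f⟩ (p ⊗ₜ[K] PiTensorProduct.tprod K y)

/-- The relations `w_*(p) ⊗ (y_1 ⊗ ⋯ ⊗ y_r) ≡ ± p ⊗ (y_{w(1)} ⊗ ⋯ ⊗ y_{w(r)})`, `w ∈ Σ_r`, which
define the coinvariants. -/
def compositeRelations (M N : SymMod.{u, v} K) (n : ℕ) : Submodule K (PreComposite M N n) :=
  Submodule.span K {z | ∃ (r : ℕ) (w : Equiv.Perm (Fin r)) (f : Fin n → Fin r) (p : M r)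
    (e : Fin r → ℕ) (y : ∀ i, N (part (w ∘ f) i).card), (∀ i, y i ∈ (N _).gr (e i)) ∧
    z = PreComposite.of M N (w ∘ f) (M.map w p) y -
      koszulSign K w e • PreComposite.of M N f p
        (fun i => N.map (finCongr (congrArg Finset.card (part_comp w f i))) (y (w i)))}

/-- The composition product
`(M ∘ N)(n) = ⨁_r (⨁_{(J_1, …, J_r)} M(r) ⊗ N(J_1) ⊗ ⋯ ⊗ N(J_r))_{Σ_r}`. -/
abbrev Composite (M N : SymMod.{u, v} K) (n : ℕ) : Type (max u v) :=
  PreComposite M N n ⧸ compositeRelations M N n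

section canonical

variable {P : Operad.{u, v} K} (R : LeftModule P) (N : SymMod.{u, v} K)
  (ι : ∀ n, N n →ₗ[K] R.obj n)

/-- The map `p ⊗ (y_1 ⊗ ⋯ ⊗ y_r) ↦ p(ι y_1, …, ι y_r)`, where the entries of the composite are
relabelled by the partition. -/
noncomputable def preCanonical (n : ℕ) : PreComposite P.toSymMod N n →ₗ[K] R.obj n :=
  letI := Classical.decEq (Σ r : ℕ, (Fin n → Fin r))
  DirectSum.toModule K _ _ fun x => TensorProduct.lift
    { toFun := fun p => (R.map (shuffle x.2)).toLin ∘ₗ PiTensorProduct.lift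
        ((R.act.comp (fun i => (part x.2 i).card) p).compLinearMap (fun i => ι _))
      map_add' := fun p q => by
        ext y; simp
      map_smul' := fun c p => by
        ext y; simp }

theorem preCanonical_of {n r : ℕ} (f : Fin n → Fin r) (p : P.obj r)
    (y : ∀ i, N (part f i).card) :
    preCanonical R N ι n (PreComposite.of P.toSymMod N f p y) =
      R.map (shuffle f) (R.act.comp _ p (fun i => ι _ (y i))) := by
  classical
  unfold preCanonical PreComposite.of
  simp

theorem shuffle_comp {n r : ℕ} (w : Equiv.Perm (Fin r)) (f : Fin n → Fin r) :
    (blockEquiv w (fun j => (part (w ∘ f) j).card)).trans (shuffle (w ∘ f)) =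
      (sumEquiv fun i => finCongr (congrArg Finset.card (part_comp w f i))).trans (shuffle f) := by
  ext x
  obtain ⟨⟨i, a⟩, rfl⟩ := finSigmaFinEquiv.surjective x
  have key : ∀ (s t : Finset (Fin n)) (h : s = t) (a : Fin s.card),
      s.orderEmbOfFin rfl a = t.orderEmbOfFin rfl (Fin.cast (congrArg Finset.card h) a) := by
    rintro s _ rfl a; rfl
  have h := key _ _ (part_comp w f i)
  simp [blockEquiv, sumEquiv, shuffle, Equiv.sigmaFiberEquiv]
  exact congrArg Fin.val (h a)

/-- The canonical map `P ∘ N → R`, `p(y_1, …, y_r) ↦ p(ι y_1, …, ι y_r)`, which extends a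
homogeneous and equivariant map `ι : N → R` to a morphism of (graded) left `P`-modules. -/
noncomputable def canonical (hgr : ∀ n k x, x ∈ (N n).gr k → ι n x ∈ (R.obj n).gr k)
    (hmap : ∀ {m n : ℕ} (e : Fin m ≃ Fin n) (x : N m), ι n (N.map e x) = R.map e (ι m x))
    (n : ℕ) : Composite P.toSymMod N n →ₗ[K] R.obj n :=
  (compositeRelations P.toSymMod N n).liftQ (preCanonical R N ι n) (by
    refine Submodule.span_le.2 ?_
    rintro _ ⟨r, w, f, p, e, y, hy, rfl⟩
    rw [SetLike.mem_coe, LinearMap.mem_ker, map_sub, map_smul, preCanonical_of, preCanonical_of,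
      sub_eq_zero]
    have h1 := R.act.comp_map_outer w _ e p (fun i => ι _ (y i)) (fun i => hgr _ _ _ (hy i))
    have h2 := R.act.comp_map_inner _ _
      (fun i => finCongr (congrArg Finset.card (part_comp w f i))) p (fun i => ι _ (y (w i)))
    simp only [hmap]
    rw [h1, h2, map_smul, ← R.map_trans, ← R.map_trans, shuffle_comp])

end canonical

/-- A left `P`-module `R` is quasi-free if `R = P ∘ N` for a dg-`Σ_*`-module `N`, with a
differential `δ + d_θ` where the composite `N ⊂ P ∘ N → P ∘ N → N` of `d_θ` with the canonical
projection vanishes.  Here the inclusion `ι : N → R` is homogeneous and equivariant but need not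
commute with differentials; the canonical map `P ∘ N → R` is an isomorphism; and, on generators,
`d_θ(y)` is the difference of the differential of `ι y` in `R` and of the image of the differential
of `y` in `N`, which is required to be decomposable.  (By the derivation relation `d_θ` is determined
by its restriction to `N`.) -/
structure QuasiFree {P : Operad.{u, v} K} (R : LeftModule P) where
  gen : SymMod.{u, v} K
  incl : ∀ n, gen n →ₗ[K] R.obj n
  incl_mem : ∀ n k x, x ∈ (gen n).gr k → incl n x ∈ (R.obj n).gr k
  incl_map : ∀ {m n : ℕ} (e : Fin m ≃ Fin n) (x : gen m),
    incl n (gen.map e x) = R.map e (incl m x)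
  bijective : ∀ n, Function.Bijective (canonical R gen incl incl_mem incl_map n)
  twist_mem : ∀ n (y : gen n),
    (R.obj n).d (incl n y) - incl n ((gen n).d y) ∈ R.decomposables n

end OperadicModules

open OperadicModules

/-!
Filter `R(n)` by the arity of the operations: the `s`-th step is spanned by the composites
`p(y_1, …, y_r)` of generators with `r ≥ s`. As `P(0) = 0`, the first step is `R(n)`, and as
moreover `P(1) = K`, the second step consists of the decomposables, so that the quotient of the
two is `R̄(n)`. The twisting term raises the filtration, hence the `s`-th graded piece is the
untwisted sum, over the partitions `{1, …, n} = J_1 ⊔ ⋯ ⊔ J_s` into non-empty parts, of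
`P(s) ⊗ R̄(J_1) ⊗ ⋯ ⊗ R̄(J_s)`. The filtration is finite because `R̄(0) = 0`.

For `s ≥ 2` only the `R̄(m)` with `m < n` occur in this sum. The Künneth theorem compares the graded
pieces, and a morphism of short exact sequences is a quasi-isomorphism in all of its components as
soon as it is one in two of them: this gives (a) directly and (b) by induction on `n`. For (c) the
same induction isolates the last piece `s = n`, which is `P(n) ⊗ R̄(1)^{⊗ n} = P(n)`.
-/

namespace OperadicModules

variable {K : Type u} [CommRing K]

/-! ### Acyclicity and mapping cones -/

section Acyclicity

variable {A A' B B' C C' : Type*} [AddCommGroup A] [Module K A] [AddCommGroup A'] [Module K A']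
  [AddCommGroup B] [Module K B] [AddCommGroup B'] [Module K B'] [AddCommGroup C] [Module K C]
  [AddCommGroup C'] [Module K C']

/-- `G` has no homology: every cycle in `G` bounds in `G`. The submodule `G` varies inside a fixed
differential module, since it will be a step of a filtration. -/
def AcyclicOn (d : A →ₗ[K] A) (G : Submodule K A) : Prop :=
  ∀ x ∈ G, d x = 0 → ∃ y ∈ G, d y = x

/-- The differential of the mapping cone of `f : A → B`, whose underlying module is `B × A`. -/
def coneDifferential (dA : A →ₗ[K] A) (dB : B →ₗ[K] B) (f : A →ₗ[K] B) : B × A →ₗ[K] B × A :=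
  (dB.coprod f).prod (-(dA ∘ₗ LinearMap.snd K B A))

@[simp]
theorem coneDifferential_apply (dA : A →ₗ[K] A) (dB : B →ₗ[K] B) (f : A →ₗ[K] B) (z : B × A) :
    coneDifferential dA dB f z = (dB z.1 + f z.2, -dA z.2) := rfl

theorem acyclicOn_bot (d : A →ₗ[K] A) : AcyclicOn d ⊥ :=
  fun _ hx _ => ⟨0, zero_mem _, by rw [map_zero, (Submodule.mem_bot K).1 hx]⟩

theorem AcyclicOn.of_equiv {dA : A →ₗ[K] A} {dB : B →ₗ[K] B} (h : AcyclicOn dA ⊤) (e : A ≃ₗ[K] B)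
    (he : ∀ x, e (dA x) = dB (e x)) : AcyclicOn dB ⊤ := by
  rintro y - hy
  obtain ⟨x, rfl⟩ := e.surjective y
  obtain ⟨z, -, rfl⟩ := h x trivial (e.injective (by rw [he, hy, map_zero]))
  exact ⟨e z, trivial, (he z).symm⟩

theorem AcyclicOn.of_contraction {d : A →ₗ[K] A} (S : A →ₗ[K] A)
    (hS : ∀ x, d (S x) + S (d x) = x) : AcyclicOn d ⊤ :=
  fun x _ hx => ⟨S x, trivial, by simpa [hx] using hS x⟩

theorem acyclicOn_cone_top_iff {dA : A →ₗ[K] A} {dB : B →ₗ[K] B} {f : A →ₗ[K] B} :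
    AcyclicOn (coneDifferential dA dB f) ⊤ ↔
      ∀ x y, dA x = 0 → f x = dB y → ∃ z w, dA z = x ∧ f z + dB w = y := by
  constructor
  · intro h x y hx hy
    obtain ⟨⟨w, z⟩, -, hwz⟩ := h (y, -x) trivial (by simp [hx, hy])
    rw [coneDifferential_apply, Prod.mk.injEq, neg_inj] at hwz
    exact ⟨z, w, hwz.2, by rw [add_comm]; exact hwz.1⟩
  · rintro h ⟨y, x⟩ - hyx
    rw [coneDifferential_apply, Prod.mk_eq_zero, neg_eq_zero] at hyx
    obtain ⟨z, w, hz, hw⟩ := h (-x) y (by simp [hyx.2]) (by simp [eq_neg_of_add_eq_zero_left hyx.1])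
    exact ⟨(w, z), trivial, by simp [hz, ← hw, add_comm]⟩

theorem acyclicOn_cone_of_bijective_square {dA : A →ₗ[K] A} {dB : B →ₗ[K] B} {f : A →ₗ[K] B}
    {dA' : A' →ₗ[K] A'} {dB' : B' →ₗ[K] B'} {f' : A' →ₗ[K] B'} (a : A →ₗ[K] A') (b : B →ₗ[K] B')
    (ha : Function.Bijective a) (hb : Function.Bijective b) (hda : ∀ x, a (dA x) = dA' (a x))
    (hdb : ∀ x, b (dB x) = dB' (b x)) (hf : ∀ x, b (f x) = f' (a x)) :
    AcyclicOn (coneDifferential dA dB f) ⊤ ↔ AcyclicOn (coneDifferential dA' dB' f') ⊤ := by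
  let e := (LinearEquiv.ofBijective b hb).prodCongr (LinearEquiv.ofBijective a ha)
  have e_comm : ∀ x, e (coneDifferential dA dB f x) = coneDifferential dA' dB' f' (e x) := by
    simp [e, hda, hdb, hf]
  exact ⟨fun h => h.of_equiv e e_comm,
    fun h => h.of_equiv e.symm fun x => by rw [e.symm_apply_eq, e_comm, e.apply_symm_apply]⟩

theorem acyclicOn_cone_pi_iff {ι : Type*} {A B : ι → Type*} [∀ i, AddCommGroup (A i)]
    [∀ i, Module K (A i)] [∀ i, AddCommGroup (B i)] [∀ i, Module K (B i)]
    {dA : ∀ i, A i →ₗ[K] A i} {dB : ∀ i, B i →ₗ[K] B i} {f : ∀ i, A i →ₗ[K] B i} :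
    AcyclicOn (coneDifferential (LinearMap.piMap dA) (LinearMap.piMap dB) (LinearMap.piMap f)) ⊤ ↔
      ∀ i, AcyclicOn (coneDifferential (dA i) (dB i) (f i)) ⊤ := by
  classical
  simp only [acyclicOn_cone_top_iff, funext_iff, Pi.zero_apply, Pi.add_apply,
    LinearMap.coe_piMap, Pi.map_apply]
  constructor
  · intro h i x y hx hy
    obtain ⟨z, w, hz, hw⟩ := h (Pi.single i x) (Pi.single i y)
      (fun j => by rcases eq_or_ne j i with rfl | hj <;> simp [*])
      (fun j => by rcases eq_or_ne j i with rfl | hj <;> simp [*])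
    exact ⟨z i, w i, by simpa using hz i, by simpa using hw i⟩
  · intro h x y hx hy
    choose z w hz hw using fun i => h i (x i) (y i) (hx i) (hy i)
    exact ⟨z, w, hz, hw⟩

/-- `0 → H → G → C → 0` is a short exact sequence of differential modules, where `G` is a stable
submodule of the differential module `A`, and `G → C` is the restriction of `q : A → C`. -/
structure ShortExactOn (d : A →ₗ[K] A) (G H : Submodule K A) (dC : C →ₗ[K] C) (q : A →ₗ[K] C) :
    Prop where
  d_d : ∀ x, d (d x) = 0
  d_mem : ∀ x ∈ G, d x ∈ G
  map_d : ∀ x ∈ G, q (d x) = dC (q x)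
  surj : ∀ t, ∃ x ∈ G, q x = t
  inf_ker : G ⊓ LinearMap.ker q = H

namespace ShortExactOn

variable {d : A →ₗ[K] A} {G H : Submodule K A} {dC : C →ₗ[K] C} {q : A →ₗ[K] C}
  {d' : A' →ₗ[K] A'} {G' H' : Submodule K A'} {dC' : C' →ₗ[K] C'} {q' : A' →ₗ[K] C'}

theorem mem_iff (h : ShortExactOn d G H dC q) {x : A} : x ∈ H ↔ x ∈ G ∧ q x = 0 := by
  rw [← h.inf_ker, Submodule.mem_inf, LinearMap.mem_ker]

theorem acyclicOn_middle (h : ShortExactOn d G H dC q) (hH : AcyclicOn d H)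
    (hC : AcyclicOn dC ⊤) : AcyclicOn d G := by
  intro x hx hdx
  obtain ⟨t, -, ht⟩ := hC (q x) trivial (by rw [← h.map_d x hx, hdx, map_zero])
  obtain ⟨y, hy, rfl⟩ := h.surj t
  obtain ⟨z, hz, hdz⟩ := hH (x - d y)
    (h.mem_iff.2 ⟨sub_mem hx (h.d_mem y hy), by rw [map_sub, h.map_d y hy, ht, sub_self]⟩)
    (by rw [map_sub, hdx, h.d_d, sub_self])
  exact ⟨z + y, add_mem (h.mem_iff.1 hz).1 hy, by rw [map_add, hdz, sub_add_cancel]⟩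

theorem acyclicOn_right (h : ShortExactOn d G H dC q) (hH : AcyclicOn d H) (hG : AcyclicOn d G) :
    AcyclicOn dC ⊤ := by
  rintro t - ht
  obtain ⟨x, hx, rfl⟩ := h.surj t
  obtain ⟨y, hy, hyx⟩ := hH (d x)
    (h.mem_iff.2 ⟨h.d_mem x hx, by rw [h.map_d x hx, ht]⟩) (h.d_d x)
  rw [h.mem_iff] at hy
  obtain ⟨z, hz, hzx⟩ := hG (x - y) (sub_mem hx hy.1) (by rw [map_sub, hyx, sub_self])
  exact ⟨q z, trivial, by rw [← h.map_d z hz, hzx, map_sub, hy.2, sub_zero]⟩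

theorem acyclicOn_left (h : ShortExactOn d G H dC q) (hG : AcyclicOn d G) (hC : AcyclicOn dC ⊤) :
    AcyclicOn d H := by
  intro x hx hdx
  rw [h.mem_iff] at hx
  obtain ⟨y, hy, rfl⟩ := hG x hx.1 hdx
  obtain ⟨t, -, ht⟩ := hC (q y) trivial (by rw [← h.map_d y hy, hx.2])
  obtain ⟨z, hz, rfl⟩ := h.surj t
  exact ⟨y - d z, h.mem_iff.2 ⟨sub_mem hy (h.d_mem z hz),
    by rw [map_sub, h.map_d z hz, ht, sub_self]⟩, by rw [map_sub, h.d_d, sub_zero]⟩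

theorem cone (h : ShortExactOn d G H dC q) (h' : ShortExactOn d' G' H' dC' q') {f : A →ₗ[K] A'}
    {g : C →ₗ[K] C'} (hd : ∀ x, f (d x) = d' (f x)) (hG : ∀ x ∈ G, f x ∈ G')
    (hg : ∀ x ∈ G, q' (f x) = g (q x)) :
    ShortExactOn (coneDifferential d d' f) (G'.prod G) (H'.prod H) (coneDifferential dC dC' g)
      (q'.prodMap q) where
  d_d x := by simp [h.d_d, h'.d_d, hd]
  d_mem := fun ⟨y, x⟩ ⟨hy, hx⟩ =>
    ⟨add_mem (h'.d_mem y hy) (hG x hx), neg_mem (h.d_mem x hx)⟩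
  map_d := by
    rintro ⟨y, x⟩ ⟨hy, hx⟩
    simp [h.map_d x hx, h'.map_d y hy, hg x hx]
  surj := by
    rintro ⟨t', t⟩
    obtain ⟨x, hx, rfl⟩ := h.surj t
    obtain ⟨y, hy, rfl⟩ := h'.surj t'
    exact ⟨(y, x), ⟨hy, hx⟩, rfl⟩
  inf_ker := by
    ext ⟨y, x⟩
    simp only [Submodule.mem_inf, Submodule.mem_prod, LinearMap.mem_ker, LinearMap.prodMap_apply,
      Prod.mk_eq_zero, h.mem_iff, h'.mem_iff]
    tauto

end ShortExactOn

end Acyclicity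

namespace DGMod

variable {V W : DGMod.{u, v} K}

theorem homogeneous_induction {p : V → Prop} (zero : p 0) (homogeneous : ∀ k, ∀ x ∈ V.gr k, p x)
    (add : ∀ x y, p x → p y → p (x + y)) (x : V) : p x := by
  have hx : x ∈ ⨆ k, V.gr k := by rw [V.isInternal.submodule_iSup_eq_top]; trivial
  exact Submodule.iSup_induction V.gr (motive := p) hx homogeneous zero add

theorem span_homogeneous (V : DGMod.{u, v} K) :
    Submodule.span K {x : V | ∃ k, x ∈ V.gr k} = ⊤ := by
  rw [eq_top_iff]
  rintro x -
  induction x using homogeneous_induction with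
  | zero => exact zero_mem _
  | homogeneous k x hx => exact Submodule.subset_span ⟨k, hx⟩
  | add x y hx hy => exact add_mem hx hy

section Piecewise

variable {X : Type*} [AddCommGroup X] [Module K X]

/-- The linear map on `V` which is the restriction of `f k` on the elements of degree `k`. -/
noncomputable def piecewise (V : DGMod.{u, v} K) (f : ℕ → V →ₗ[K] X) : V →ₗ[K] X :=
  DirectSum.toModule K ℕ X (fun k => f k ∘ₗ (V.gr k).subtype) ∘ₗ
    (LinearEquiv.ofBijective (DirectSum.coeLinearMap V.gr) V.isInternal).symm.toLinearMap

theorem piecewise_of_mem (f : ℕ → V →ₗ[K] X) {k : ℕ} {x : V} (hx : x ∈ V.gr k) :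
    V.piecewise f x = f k x := by
  have symm_eq_lof : (LinearEquiv.ofBijective (DirectSum.coeLinearMap V.gr) V.isInternal).symm x =
      DirectSum.lof K ℕ (fun k => V.gr k) k ⟨x, hx⟩ := by
    rw [LinearEquiv.symm_apply_eq]
    exact (DirectSum.coeLinearMap_lof V.gr k ⟨x, hx⟩).symm
  rw [piecewise, LinearMap.comp_apply, LinearEquiv.coe_coe, symm_eq_lof, DirectSum.toModule_lof]
  rfl

end Piecewise

/-- The sign operator `x ↦ (-1)^|x| x`, from which the signs of tensor products are built. -/
noncomputable def sgn (V : DGMod.{u, v} K) : V →ₗ[K] V :=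
  V.piecewise fun k => (-1 : K) ^ k • LinearMap.id

/-- The projection of `V` onto its component of degree `k`, as an endomorphism of `V`. -/
noncomputable def proj (V : DGMod.{u, v} K) (k : ℕ) : V →ₗ[K] V :=
  V.piecewise fun l => if l = k then LinearMap.id else 0

theorem sgn_of_mem {k : ℕ} {x : V} (hx : x ∈ V.gr k) : V.sgn x = (-1 : K) ^ k • x :=
  piecewise_of_mem _ hx

theorem proj_of_mem {k : ℕ} (l : ℕ) {x : V} (hx : x ∈ V.gr k) :
    V.proj l x = if k = l then x else 0 := by
  rw [proj, piecewise_of_mem _ hx]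
  split_ifs <;> rfl

theorem sgn_mem {k : ℕ} {x : V} (hx : x ∈ V.gr k) : V.sgn x ∈ V.gr k := by
  rw [sgn_of_mem hx]
  exact Submodule.smul_mem _ _ hx

theorem sgn_sgn (x : V) : V.sgn (V.sgn x) = x := by
  induction x using homogeneous_induction with
  | zero => simp
  | homogeneous k x hx =>
    rw [sgn_of_mem hx, map_smul, sgn_of_mem hx, smul_smul, ← mul_pow]
    simp
  | add x y hx hy => simp only [map_add, hx, hy]

theorem sgn_d (x : V) : V.sgn (V.d x) = -V.d (V.sgn x) := by
  induction x using homogeneous_induction with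
  | zero => simp
  | homogeneous k x hx =>
    rw [sgn_of_mem hx, map_smul]
    cases k with
    | zero => simp [V.d_zero x hx]
    | succ k => simp [sgn_of_mem (V.d_mem k x hx), pow_succ]
  | add x y hx hy => simp only [map_add, hx, hy, neg_add]

theorem proj_d (k : ℕ) (x : V) : V.proj k (V.d x) = V.d (V.proj (k + 1) x) := by
  induction x using homogeneous_induction with
  | zero => simp
  | homogeneous l x hx =>
    rw [proj_of_mem _ hx]
    cases l with
    | zero => simp [V.d_zero x hx]
    | succ l => by_cases h : l = k <;> simp [proj_of_mem _ (V.d_mem l x hx), h]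
  | add x y hx hy => simp only [map_add, hx, hy]

theorem proj_proj (k l : ℕ) (x : V) : V.proj k (V.proj l x) = if k = l then V.proj k x else 0 := by
  induction x using homogeneous_induction with
  | zero => simp
  | homogeneous j x hx =>
    by_cases hl : j = l
    · subst hl
      by_cases hk : k = j <;> simp [proj_of_mem _ hx, hk, Ne.symm]
    · by_cases hk : k = l <;> simp [proj_of_mem _ hx, hl, hk]
  | add x y hx hy => simp only [map_add, hx, hy]; split_ifs <;> simp

theorem proj_mem (k : ℕ) (x : V) : V.proj k x ∈ V.gr k := by
  induction x using homogeneous_induction with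
  | zero => simp
  | homogeneous l x hx =>
    rw [proj_of_mem _ hx]
    split_ifs with h
    · exact h ▸ hx
    · exact zero_mem _
  | add x y hx hy => rw [map_add]; exact add_mem hx hy

theorem exists_sum_proj_eq (x : V) : ∃ N, ∀ M ≥ N, ∑ k ∈ Finset.range M, V.proj k x = x := by
  induction x using homogeneous_induction with
  | zero => exact ⟨0, fun M _ => by simp⟩
  | homogeneous l x hx =>
    refine ⟨l + 1, fun M hM => ?_⟩
    simp only [proj_of_mem _ hx, Finset.sum_ite_eq, Finset.mem_range]
    rw [if_pos (by omega)]
  | add x y hx hy =>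
    obtain ⟨N, hN⟩ := hx
    obtain ⟨N', hN'⟩ := hy
    refine ⟨max N N', fun M hM => ?_⟩
    simp only [map_add, Finset.sum_add_distrib]
    rw [hN M (le_of_max_le_left hM), hN' M (le_of_max_le_right hM)]

theorem Hom.map_sgn (f : Hom V W) (x : V) : f (V.sgn x) = W.sgn (f x) := by
  induction x using homogeneous_induction with
  | zero => simp
  | homogeneous k x hx => rw [sgn_of_mem hx, map_smul, sgn_of_mem (f.map_mem k x hx)]
  | add x y hx hy => simp only [map_add, hx, hy]

theorem Hom.map_proj (f : Hom V W) (k : ℕ) (x : V) : f (V.proj k x) = W.proj k (f x) := by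
  induction x using homogeneous_induction with
  | zero => simp
  | homogeneous l x hx =>
    rw [proj_of_mem _ hx, proj_of_mem _ (f.map_mem l x hx)]
    split_ifs <;> simp
  | add x y hx hy => simp only [map_add, hx, hy]

theorem isInternal_of_projections {X : Type*} [AddCommGroup X] [Module K X]
    {gr : ℕ → Submodule K X} (p : ℕ → X →ₗ[K] X) (h_same : ∀ k, ∀ x ∈ gr k, p k x = x)
    (h_ne : ∀ k l, l ≠ k → ∀ x ∈ gr l, p k x = 0) (h_top : ⨆ k, gr k = ⊤) :
    DirectSum.IsInternal gr := by
  rw [DirectSum.isInternal_submodule_iff_iSupIndep_and_iSup_eq_top, iSupIndep_def]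
  refine ⟨fun k => Submodule.disjoint_def.2 fun x hx hx' => ?_, h_top⟩
  have hker : ⨆ l, ⨆ (_ : l ≠ k), gr l ≤ LinearMap.ker (p k) :=
    iSup₂_le fun l hl x hx => h_ne k l hl x hx
  rw [← h_same k x hx]
  exact hker hx'

theorem Hom.homologyMap_injective_iff (f : Hom V W) :
    Function.Injective f.homologyMap ↔ ∀ x y, V.d x = 0 → f x = W.d y → ∃ z, V.d z = x := by
  rw [injective_iff_map_eq_zero]
  constructor
  · intro h x y hx hy
    exact (Submodule.Quotient.mk_eq_zero _).1 (h (Submodule.Quotient.mk ⟨x, hx⟩)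
      ((Submodule.Quotient.mk_eq_zero _).2 ⟨y, hy.symm⟩))
  · rintro h ⟨x, hx⟩ hfx
    obtain ⟨y, hy⟩ := (Submodule.Quotient.mk_eq_zero _).1 hfx
    exact (Submodule.Quotient.mk_eq_zero _).2 (h x y hx hy.symm)

theorem Hom.homologyMap_surjective_iff (f : Hom V W) :
    Function.Surjective f.homologyMap ↔
      ∀ y, W.d y = 0 → ∃ x w, V.d x = 0 ∧ f x + W.d w = y := by
  constructor
  · intro h y hy
    obtain ⟨⟨x, hx⟩, hxy⟩ := h (Submodule.Quotient.mk ⟨y, hy⟩)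
    obtain ⟨w, hw⟩ := (Submodule.Quotient.eq _).1 hxy.symm
    exact ⟨x, w, hx, by rw [hw]; exact add_sub_cancel _ _⟩
  · rintro h ⟨y, hy⟩
    obtain ⟨x, w, hx, rfl⟩ := h y hy
    refine ⟨Submodule.Quotient.mk ⟨x, hx⟩, Eq.symm ((Submodule.Quotient.eq _).2 ?_)⟩
    exact ⟨w, (add_sub_cancel_left _ _).symm⟩

theorem Hom.isQuasiIso_iff_acyclicOn_cone (f : Hom V W) :
    f.IsQuasiIso ↔ AcyclicOn (coneDifferential V.d W.d f.toLin) ⊤ := by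
  rw [acyclicOn_cone_top_iff, Hom.IsQuasiIso, Function.Bijective, Hom.homologyMap_injective_iff,
    Hom.homologyMap_surjective_iff]
  constructor
  · rintro ⟨hinj, hsurj⟩ x y hx hy
    obtain ⟨z, rfl⟩ := hinj x y hx hy
    obtain ⟨t, w, ht, hw⟩ := hsurj (y - f z) (by rw [map_sub, ← hy, ← f.map_d, sub_self])
    exact ⟨z + t, w, by rw [map_add, ht, add_zero], by
      rw [map_add, add_assoc, hw, add_sub_cancel]⟩
  · refine fun h => ⟨fun x y hx hy => ?_, fun y hy => ?_⟩
    · obtain ⟨z, -, hz, -⟩ := h x y hx hy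
      exact ⟨z, hz⟩
    · obtain ⟨x, w, hx, hw⟩ := h 0 y (map_zero _) (by rw [map_zero, hy])
      exact ⟨x, w, hx, hw⟩

theorem Hom.isQuasiIso_iff_of_bijective_square {V' W' : DGMod.{u, v} K} {f : Hom V W}
    {f' : Hom V' W'} (a : V →ₗ[K] V') (b : W →ₗ[K] W') (ha : Function.Bijective a)
    (hb : Function.Bijective b) (hda : ∀ x, a (V.d x) = V'.d (a x))
    (hdb : ∀ x, b (W.d x) = W'.d (b x)) (hf : ∀ x, b (f x) = f' (a x)) :
    f.IsQuasiIso ↔ f'.IsQuasiIso := by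
  rw [f.isQuasiIso_iff_acyclicOn_cone, f'.isQuasiIso_iff_acyclicOn_cone]
  exact acyclicOn_cone_of_bijective_square a b ha hb hda hdb hf

theorem Hom.IsQuasiIso.of_bijective {f : Hom V W} (hf : Function.Bijective f) : f.IsQuasiIso := by
  rw [Hom.IsQuasiIso, Function.Bijective, Hom.homologyMap_injective_iff,
    Hom.homologyMap_surjective_iff]
  refine ⟨fun x y _ hy => ?_, fun y hy => ?_⟩
  · obtain ⟨z, rfl⟩ := hf.surjective y
    exact ⟨z, hf.injective (by rw [f.map_d, hy])⟩
  · obtain ⟨x, rfl⟩ := hf.surjective y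
    exact ⟨x, 0, hf.injective (by rw [f.map_d, hy, map_zero]), by rw [map_zero, add_zero]⟩

theorem Hom.IsQuasiIso.bijective_of_d_eq_zero {f : Hom V W} (hf : f.IsQuasiIso)
    (hV : ∀ x, V.d x = 0) (hW : ∀ y, W.d y = 0) : Function.Bijective f := by
  rw [Hom.IsQuasiIso, Function.Bijective, Hom.homologyMap_injective_iff,
    Hom.homologyMap_surjective_iff] at hf
  refine ⟨(injective_iff_map_eq_zero f.toLin).2 fun x hx => ?_, fun y => ?_⟩
  · obtain ⟨z, rfl⟩ := hf.1 x 0 (hV x) (by rw [hx, map_zero])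
    exact hV z
  · obtain ⟨x, w, -, rfl⟩ := hf.2 y (hW y)
    exact ⟨x, by rw [hW w, add_zero]⟩

theorem Hom.ext_toLin {f g : Hom V W} (h : f.toLin = g.toLin) : f = g := by
  cases f
  cases g
  congr

/-- The composite of two morphisms. -/
def Hom.comp {U : DGMod.{u, v} K} (g : Hom V W) (f : Hom U V) : Hom U W where
  toLin := g.toLin ∘ₗ f.toLin
  map_mem k x hx := g.map_mem k _ (f.map_mem k x hx)
  map_d x := by simp [f.map_d, g.map_d]

theorem Hom.IsQuasiIso.comp {U : DGMod.{u, v} K} {g : Hom V W} {f : Hom U V}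
    (hg : g.IsQuasiIso) (hf : f.IsQuasiIso) : (g.comp f).IsQuasiIso := by
  have homologyMap_comp : (g.comp f).homologyMap = g.homologyMap ∘ₗ f.homologyMap := by
    ext
    rfl
  rw [Hom.IsQuasiIso, homologyMap_comp, LinearMap.coe_comp]
  exact Function.Bijective.comp hg hf

end DGMod

namespace DGMod

open TensorProduct (map_tmul)

variable {V W : DGMod.{u, v} K}

section Cone

/-- The projection of the cone of a map `V → W` onto its component `W_k ⊕ V_{k-1}` of degree
`k`. -/
noncomputable def coneProj (V W : DGMod.{u, v} K) : ℕ → W × V →ₗ[K] W × V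
  | 0 => (W.proj 0).prodMap 0
  | k + 1 => (W.proj (k + 1)).prodMap (V.proj k)

/-- The component `W_k ⊕ V_{k-1}` of degree `k` of the cone of a map `V → W`. -/
def coneGr (V W : DGMod.{u, v} K) : ℕ → Submodule K (W × V)
  | 0 => (W.gr 0).prod ⊥
  | k + 1 => (W.gr (k + 1)).prod (V.gr k)

theorem isInternal_coneGr (V W : DGMod.{u, v} K) : DirectSum.IsInternal (coneGr V W) := by
  refine isInternal_of_projections (coneProj V W) ?_ ?_ (Submodule.eq_top_iff'.2 ?_)
  · rintro (_ | k) ⟨y, x⟩ ⟨hy, hx⟩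
    · simpa [coneProj, proj_of_mem _ hy] using ((Submodule.mem_bot K).1 hx).symm
    · simp [coneProj, proj_of_mem _ hy, proj_of_mem _ hx]
  · rintro (_ | k) (_ | l) hkl ⟨y, x⟩ ⟨hy, hx⟩
    · exact absurd rfl hkl
    · simp [coneProj, proj_of_mem _ hy]
    · obtain rfl := (Submodule.mem_bot K).1 hx
      simp [coneProj, proj_of_mem _ hy]
    · have hkl' : l ≠ k := fun h => hkl (congrArg _ h)
      simp [coneProj, proj_of_mem _ hy, proj_of_mem _ hx, hkl']
  · rintro ⟨y, x⟩
    rw [← zero_add x, ← add_zero y, ← Prod.mk_add_mk]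
    refine add_mem ?_ ?_
    · induction y using homogeneous_induction with
      | zero => exact zero_mem _
      | homogeneous k y hy =>
        refine Submodule.mem_iSup_of_mem k ?_
        cases k <;> exact ⟨hy, zero_mem _⟩
      | add y z hy hz => simpa using add_mem hy hz
    · induction x using homogeneous_induction with
      | zero => exact zero_mem _
      | homogeneous k x hx =>
        exact Submodule.mem_iSup_of_mem (k + 1) ⟨zero_mem (W.gr (k + 1)), hx⟩
      | add y z hy hz => simpa using add_mem hy hz

/-- The mapping cone of a morphism of dg-modules. -/
noncomputable abbrev Hom.cone (f : Hom V W) : DGMod.{u, v} K where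
  carrier := W × V
  gr := coneGr V W
  isInternal := isInternal_coneGr V W
  d := coneDifferential V.d W.d f.toLin
  d_mem := by
    rintro (_ | k) ⟨y, x⟩ ⟨hy, hx⟩
    · exact ⟨add_mem (W.d_mem 0 y hy) (f.map_mem 0 x hx), by simpa using V.d_zero x hx⟩
    · exact ⟨add_mem (W.d_mem _ y hy) (f.map_mem _ x hx), neg_mem (V.d_mem _ x hx)⟩
  d_zero := by
    rintro ⟨y, x⟩ ⟨hy, hx⟩
    obtain rfl := (Submodule.mem_bot K).1 hx
    simpa using W.d_zero y hy
  d_d x := by simp [V.d_d, W.d_d, f.map_d]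

theorem Hom.isQuasiIso_iff_acyclicOn (f : Hom V W) : f.IsQuasiIso ↔ AcyclicOn f.cone.d ⊤ :=
  f.isQuasiIso_iff_acyclicOn_cone

theorem Hom.cone_sgn (f : Hom V W) (z : W × V) :
    f.cone.sgn z = (W.sgn z.1, -V.sgn z.2) := by
  induction z using homogeneous_induction (V := f.cone) with
  | zero => exact Prod.ext (by simp) (by simp)
  | add z z' hz hz' => rw [map_add, hz, hz']; simp [add_comm]
  | homogeneous k z hz =>
    rw [sgn_of_mem hz]
    rcases k with _ | k
    · have hz₂ : z.2 = 0 := (Submodule.mem_bot K).1 hz.2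
      exact Prod.ext (sgn_of_mem hz.1).symm (by simp [hz₂])
    · refine Prod.ext (sgn_of_mem hz.1).symm ?_
      rw [sgn_of_mem hz.2]
      simp [pow_succ]

end Cone

/-! ### Tensor products -/

section Tensor

variable (A B : DGMod.{u, v} K)

/-- The component of degree `n` of a tensor product of graded modules. -/
def tensorGr (n : ℕ) : Submodule K (A ⊗[K] B) :=
  Submodule.span K {t | ∃ i j a b, i + j = n ∧ a ∈ A.gr i ∧ b ∈ B.gr j ∧ a ⊗ₜ b = t}

variable {A B} in
theorem tmul_mem_tensorGr {i j : ℕ} {a : A} {b : B} (ha : a ∈ A.gr i) (hb : b ∈ B.gr j) :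
    a ⊗ₜ[K] b ∈ tensorGr A B (i + j) :=
  Submodule.subset_span ⟨i, j, a, b, rfl, ha, hb, rfl⟩

/-- The projection of a tensor product onto its component of degree `n`. -/
noncomputable def tensorProj (n : ℕ) : A ⊗[K] B →ₗ[K] A ⊗[K] B :=
  ∑ ij ∈ Finset.HasAntidiagonal.antidiagonal n, TensorProduct.map (A.proj ij.1) (B.proj ij.2)

variable {A B} in
theorem tensorProj_tmul (n : ℕ) {i j : ℕ} {a : A} {b : B} (ha : a ∈ A.gr i) (hb : b ∈ B.gr j) :
    tensorProj A B n (a ⊗ₜ b) = if i + j = n then a ⊗ₜ b else 0 := by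
  have h : ∀ kl : ℕ × ℕ, A.proj kl.1 a ⊗ₜ[K] B.proj kl.2 b =
      if (i, j) = kl then a ⊗ₜ b else 0 := by
    rintro ⟨k, l⟩
    rw [proj_of_mem _ ha, proj_of_mem _ hb]
    by_cases hk : i = k <;> by_cases hl : j = l <;> simp [hk, hl]
  simp only [tensorProj, LinearMap.sum_apply, map_tmul, h, Finset.sum_ite_eq,
    Finset.HasAntidiagonal.mem_antidiagonal]

theorem isInternal_tensorGr : DirectSum.IsInternal (tensorGr A B) := by
  have hproj : ∀ n m, ∀ t ∈ tensorGr A B m, tensorProj A B n t = if m = n then t else 0 := by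
    intro n m t ht
    induction ht using Submodule.span_induction with
    | mem t ht =>
      obtain ⟨i, j, a, b, rfl, ha, hb, rfl⟩ := ht
      exact tensorProj_tmul n ha hb
    | zero => simp
    | add t t' _ _ ht ht' => rw [map_add, ht, ht']; split_ifs <;> simp
    | smul c t _ ht => rw [map_smul, ht]; split_ifs <;> simp
  refine isInternal_of_projections (tensorProj A B) (fun n t ht => ?_) (fun n m hmn t ht => ?_)
    (Submodule.eq_top_iff'.2 fun t => ?_)
  · rw [hproj n n t ht, if_pos rfl]
  · rw [hproj n m t ht, if_neg hmn]
  · induction t with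
    | zero => exact zero_mem _
    | add t t' ht ht' => exact add_mem ht ht'
    | tmul a b =>
      induction a using homogeneous_induction with
      | zero => simp
      | add a a' ha ha' => rw [TensorProduct.add_tmul]; exact add_mem ha ha'
      | homogeneous i a ha =>
        induction b using homogeneous_induction with
        | zero => simp
        | add b b' hb hb' => rw [TensorProduct.tmul_add]; exact add_mem hb hb'
        | homogeneous j b hb => exact Submodule.mem_iSup_of_mem _ (tmul_mem_tensorGr ha hb)

/-- The differential `d(a ⊗ b) = da ⊗ b + (-1)^|a| a ⊗ db` of a tensor product. -/
noncomputable def tensorDifferential : A ⊗[K] B →ₗ[K] A ⊗[K] B :=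
  TensorProduct.map A.d LinearMap.id + TensorProduct.map A.sgn B.d

theorem tensorDifferential_tmul (a : A) (b : B) :
    tensorDifferential A B (a ⊗ₜ b) = A.d a ⊗ₜ b + A.sgn a ⊗ₜ B.d b := rfl

theorem tensorDifferential_mem (n : ℕ) (t : A ⊗[K] B) (ht : t ∈ tensorGr A B (n + 1)) :
    tensorDifferential A B t ∈ tensorGr A B n := by
  induction ht using Submodule.span_induction with
  | zero => simp
  | add t t' _ _ ht ht' => rw [map_add]; exact add_mem ht ht'
  | smul c t _ ht => rw [map_smul]; exact Submodule.smul_mem _ c ht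
  | mem t ht =>
    obtain ⟨i, j, a, b, hij, ha, hb, rfl⟩ := ht
    rw [tensorDifferential_tmul]
    refine add_mem ?_ ?_
    · cases i with
      | zero => simp [A.d_zero a ha]
      | succ i =>
        rw [show n = i + j by omega]
        exact tmul_mem_tensorGr (A.d_mem i a ha) hb
    · cases j with
      | zero => simp [B.d_zero b hb]
      | succ j =>
        rw [show n = i + j by omega]
        exact tmul_mem_tensorGr (sgn_mem ha) (B.d_mem j b hb)

theorem tensorDifferential_zero (t : A ⊗[K] B) (ht : t ∈ tensorGr A B 0) :
    tensorDifferential A B t = 0 := by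
  induction ht using Submodule.span_induction with
  | zero => simp
  | add t t' _ _ ht ht' => rw [map_add, ht, ht', add_zero]
  | smul c t _ ht => rw [map_smul, ht, smul_zero]
  | mem t ht =>
    obtain ⟨i, j, a, b, hij, ha, hb, rfl⟩ := ht
    obtain ⟨rfl, rfl⟩ : i = 0 ∧ j = 0 := by omega
    simp [tensorDifferential_tmul, A.d_zero a ha, B.d_zero b hb]

/-- The tensor product of dg-modules. -/
noncomputable abbrev tensor : DGMod.{u, v} K where
  carrier := A ⊗[K] B
  gr := tensorGr A B
  isInternal := isInternal_tensorGr A B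
  d := tensorDifferential A B
  d_mem := tensorDifferential_mem A B
  d_zero := tensorDifferential_zero A B
  d_d t := by
    induction t with
    | zero => simp
    | add t t' ht ht' => rw [map_add, map_add, ht, ht', add_zero]
    | tmul a b =>
      simp [tensorDifferential_tmul, A.d_d, B.d_d, A.sgn_d, TensorProduct.neg_tmul]

variable {A B}

theorem tensor_d_tmul (a : A) (b : B) :
    (A.tensor B).d (a ⊗ₜ b) = A.d a ⊗ₜ b + A.sgn a ⊗ₜ B.d b := rfl

/-- The tensor product of two morphisms. -/
noncomputable abbrev Hom.tensor {A' B' : DGMod.{u, v} K} (f : Hom A A') (g : Hom B B') :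
    Hom (A.tensor B) (A'.tensor B') where
  toLin := TensorProduct.map f.toLin g.toLin
  map_mem n t ht := by
    induction ht using Submodule.span_induction with
    | zero => simp
    | add t t' _ _ ht ht' => rw [map_add]; exact add_mem ht ht'
    | smul c t _ ht => rw [map_smul]; exact Submodule.smul_mem _ c ht
    | mem t ht =>
      obtain ⟨i, j, a, b, rfl, ha, hb, rfl⟩ := ht
      exact tmul_mem_tensorGr (f.map_mem i a ha) (g.map_mem j b hb)
  map_d t := by
    induction t using TensorProduct.induction_on with
    | zero => simp
    | add t t' ht ht' => simp only [map_add, ht, ht']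
    | tmul a b => simp [tensorDifferential_tmul, f.map_d, g.map_d, f.map_sgn]

end Tensor

end DGMod

/-! ### The Künneth theorem -/

theorem acyclicOn_add {X : Type*} [AddCommGroup X] [Module K X] {d₁ d₂ : X →ₗ[K] X}
    (p : ℕ → X →ₗ[K] X) (hp : ∀ k l x, p k (p l x) = if k = l then p k x else 0)
    (hsum : ∀ x, ∃ N, ∑ k ∈ Finset.range N, p k x = x)
    (hp₁ : ∀ k x, p k (d₁ x) = d₁ (p k x)) (hp₂ : ∀ k x, p k (d₂ x) = d₂ (p (k + 1) x))
    (hd : ∀ x, (d₁ + d₂) ((d₁ + d₂) x) = 0) (h₁ : AcyclicOn d₁ ⊤) : AcyclicOn (d₁ + d₂) ⊤ := by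
  have p_eq_zero : ∀ N x, ∑ k ∈ Finset.range N, p k x = x → ∀ k ≥ N, p k x = 0 := by
    intro N x hN k hk
    rw [← hN, map_sum]
    exact Finset.sum_eq_zero fun l hl => by
      rw [hp, if_neg (by have := Finset.mem_range.1 hl; omega)]
  -- The top component of a cycle is a cycle of `d₁`, so it can be removed by adding a boundary.
  suffices key : ∀ N x, (d₁ + d₂) x = 0 → (∀ k ≥ N, p k x = 0) → ∃ y, (d₁ + d₂) y = x by
    intro x _ hx
    obtain ⟨N, hN⟩ := hsum x
    obtain ⟨y, hy⟩ := key N x hx (p_eq_zero N x hN)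
    exact ⟨y, trivial, hy⟩
  intro N
  induction N with
  | zero =>
    intro x _ h
    obtain ⟨N, hN⟩ := hsum x
    exact ⟨0, by rw [map_zero, ← hN, Finset.sum_eq_zero fun k _ => h k k.zero_le]⟩
  | succ N ih =>
    intro x hx h
    have top_cycle : d₁ (p N x) = 0 := by
      have hN := congrArg (p N) hx
      rwa [LinearMap.add_apply, map_add, hp₁, hp₂, h (N + 1) le_rfl, map_zero, map_zero,
        add_zero] at hN
    obtain ⟨z, -, hz⟩ := h₁ (p N x) trivial top_cycle
    obtain ⟨y, hy⟩ := ih (x - (d₁ + d₂) (p N z)) (by rw [map_sub, hx, hd, sub_zero])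
      fun k hk => by
        rw [map_sub, LinearMap.add_apply, map_add, hp₁, hp₂, hp, hp,
          if_neg (by omega : k + 1 ≠ N), map_zero, add_zero]
        rcases eq_or_ne k N with rfl | hkN
        · rw [if_pos rfl, ← hp₁, hz, hp, if_pos rfl, sub_self]
        · rw [if_neg hkN, map_zero, sub_zero, h k (by omega)]
    exact ⟨y + p N z, by rw [map_add, hy, sub_add_cancel]⟩

namespace DGMod

open TensorProduct (map_tmul)

variable {V W A B C : DGMod.{u, v} K}

theorem acyclicOn_rTensor [Module.Flat K B] (hC : AcyclicOn C.d ⊤) :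
    AcyclicOn (TensorProduct.map C.d (LinearMap.id : B →ₗ[K] B)) ⊤ := by
  have hex : Function.Exact C.d C.d := fun x =>
    ⟨fun hx => (hC x trivial hx).imp fun _ h => h.2, by rintro ⟨y, rfl⟩; exact C.d_d y⟩
  intro x _ hx
  obtain ⟨y, hy⟩ := (Module.Flat.rTensor_exact B hex x).1 hx
  exact ⟨y, trivial, hy⟩

theorem exists_sum_map_id_proj_eq (x : C ⊗[K] B) : ∃ N, ∀ M ≥ N,
    ∑ k ∈ Finset.range M, TensorProduct.map LinearMap.id (B.proj k) x = x := by
  induction x with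
  | zero => exact ⟨0, fun M _ => by simp⟩
  | tmul c b =>
    obtain ⟨N, hN⟩ := exists_sum_proj_eq b
    exact ⟨N, fun M hM => by simp only [map_tmul, ← TensorProduct.tmul_sum, hN M hM,
      LinearMap.id_apply]⟩
  | add x y hx hy =>
    obtain ⟨N, hN⟩ := hx
    obtain ⟨N', hN'⟩ := hy
    exact ⟨max N N', fun M hM => by simp only [map_add, Finset.sum_add_distrib,
      hN M (le_of_max_le_left hM), hN' M (le_of_max_le_right hM)]⟩

theorem acyclicOn_tensor [Module.Flat K B] (hC : AcyclicOn C.d ⊤) :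
    AcyclicOn (C.tensor B).d ⊤ := by
  let p (k : ℕ) : C ⊗[K] B →ₗ[K] C ⊗[K] B := TensorProduct.map LinearMap.id (B.proj k)
  have exists_sum_p_eq : ∀ x, ∃ N, ∑ k ∈ Finset.range N, p k x = x := fun x =>
    (exists_sum_map_id_proj_eq x).imp fun N hN => hN N le_rfl
  have p_p : ∀ k l x, p k (p l x) = if k = l then p k x else 0 := fun k l x => by
    induction x with
    | zero => simp
    | add x y hx hy => simp only [map_add, hx, hy]; split_ifs <;> simp
    | tmul c b => simp only [p, map_tmul, proj_proj]; split_ifs <;> simp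
  refine acyclicOn_add p p_p exists_sum_p_eq (fun k x => ?_) (fun k x => ?_)
    (C.tensor B).d_d (acyclicOn_rTensor hC)
  · induction x using TensorProduct.induction_on with
    | zero => simp
    | add x y hx hy => simp only [map_add, hx, hy]
    | tmul c b => simp [p]
  · induction x using TensorProduct.induction_on with
    | zero => simp
    | add x y hx hy => simp only [map_add, hx, hy]
    | tmul c b => simp [p, proj_d]

theorem exists_lift_cycles [Module.Projective K V] (hV : AcyclicOn V.d ⊤) (f : V →ₗ[K] V)
    (hf : ∀ x, V.d (f x) = 0) : ∃ s : V →ₗ[K] V, ∀ x, V.d (s x) = f x := by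
  have hmem : ∀ x, f x ∈ LinearMap.range V.d := fun x =>
    (hV (f x) trivial (hf x)).imp fun _ h => h.2
  obtain ⟨s, hs⟩ := Module.projective_lifting_property V.d.rangeRestrict
    (f.codRestrict (LinearMap.range V.d) hmem) V.d.surjective_rangeRestrict
  exact ⟨s, fun x => congrArg Subtype.val (LinearMap.congr_fun hs x)⟩

theorem exists_contraction [Module.Projective K V] (hV : AcyclicOn V.d ⊤) :
    ∃ S : V →ₗ[K] V, ∀ x, V.d (S x) + S (V.d x) = x := by
  let InvertsOnCycles (k : ℕ) (s : V →ₗ[K] V) : Prop := ∀ x ∈ V.gr k, V.d x = 0 → V.d (s x) = x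
  obtain ⟨s₀, hs₀⟩ : ∃ s : V →ₗ[K] V, ∀ x ∈ V.gr 0, V.d (s x) = x := by
    obtain ⟨s, hs⟩ := exists_lift_cycles hV (V.proj 0) fun x => V.d_zero _ (proj_mem 0 x)
    exact ⟨s, fun x hx => by rw [hs, proj_of_mem _ hx, if_pos rfl]⟩
  have exists_next : ∀ k s, InvertsOnCycles k s →
      ∃ s' : V →ₗ[K] V, ∀ x ∈ V.gr (k + 1), V.d (s' x) = x - s (V.d x) := by
    intro k s hs
    obtain ⟨s', hs'⟩ := exists_lift_cycles hV
      (V.proj (k + 1) - s ∘ₗ V.d ∘ₗ V.proj (k + 1)) fun x => by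
        have h := hs _ (V.d_mem k _ (proj_mem (k + 1) x)) (V.d_d _)
        simp [h]
    exact ⟨s', fun x hx => by simp [hs', proj_of_mem _ hx]⟩
  choose next hnext using exists_next
  let s : ∀ k, {s // InvertsOnCycles k s} := fun k => Nat.rec ⟨s₀, fun x hx _ => hs₀ x hx⟩
    (fun k s => ⟨next k s.1 s.2, fun x hx hdx => by rw [hnext k s.1 s.2 x hx, hdx]; simp⟩) k
  refine ⟨V.piecewise fun k => (s k).1, fun x => ?_⟩
  induction x using homogeneous_induction with
  | zero => simp
  | add x y hx hy => simpa [add_add_add_comm] using congrArg₂ (· + ·) hx hy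
  | homogeneous k x hx =>
    rw [piecewise_of_mem _ hx]
    cases k with
    | zero => rw [V.d_zero x hx, map_zero, add_zero]; exact hs₀ x hx
    | succ k =>
      rw [piecewise_of_mem _ (V.d_mem k x hx)]
      exact add_eq_of_eq_sub (hnext k (s k).1 (s k).2 x hx)

theorem acyclicOn_tensor_of_contraction {S : V →ₗ[K] V} (hS : ∀ x, V.d (S x) + S (V.d x) = x) :
    AcyclicOn (A.tensor V).d ⊤ := by
  refine AcyclicOn.of_contraction (TensorProduct.map A.sgn S) fun t => ?_
  induction t using TensorProduct.induction_on with
  | zero => simp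
  | add t t' ht ht' => simpa [add_add_add_comm] using congrArg₂ (· + ·) ht ht'
  | tmul a x =>
    have h := congrArg (a ⊗ₜ[K] ·) (hS x)
    simp only [TensorProduct.tmul_add] at h
    refine Eq.trans ?_ h
    simp [tensorDifferential_tmul, sgn_sgn, sgn_d, TensorProduct.neg_tmul]
    abel

/-- The identity morphism. -/
def Hom.id (V : DGMod.{u, v} K) : Hom V V where
  toLin := LinearMap.id
  map_mem _ _ hx := hx
  map_d _ := rfl

@[simp]
theorem Hom.id_toLin (V : DGMod.{u, v} K) : (Hom.id V).toLin = LinearMap.id := rfl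

theorem Hom.IsQuasiIso.tensor_id {f : Hom V W} (hf : f.IsQuasiIso) [Module.Flat K B] :
    (f.tensor (Hom.id B)).IsQuasiIso := by
  rw [Hom.isQuasiIso_iff_acyclicOn] at hf ⊢
  refine (acyclicOn_tensor (B := B) hf).of_equiv (TensorProduct.prodLeft K K W V B) fun t => ?_
  induction t using TensorProduct.induction_on with
  | zero => simp only [map_zero]
  | add t t' ht ht' => simp only [map_add, ht, ht']
  | tmul z b =>
    change TensorProduct.prodLeft K K W V B (f.cone.d z ⊗ₜ b + f.cone.sgn z ⊗ₜ B.d b) = _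
    rw [Hom.cone_sgn]
    obtain ⟨y, x⟩ := z
    simp [tensorDifferential_tmul, TensorProduct.add_tmul, TensorProduct.neg_tmul,
      add_comm, add_assoc]

theorem Hom.IsQuasiIso.id_tensor [Module.Projective K V] [Module.Projective K W] {g : Hom V W}
    (hg : g.IsQuasiIso) : ((Hom.id A).tensor g).IsQuasiIso := by
  rw [Hom.isQuasiIso_iff_acyclicOn] at hg ⊢
  obtain ⟨S, hS⟩ := exists_contraction hg
  let σ : A ⊗[K] V ≃ₗ[K] A ⊗[K] V :=
    TensorProduct.congr (LinearEquiv.ofInvolutive A.sgn sgn_sgn) (LinearEquiv.refl K V)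
  refine (acyclicOn_tensor_of_contraction (A := A) hS).of_equiv
    (TensorProduct.prodRight K K A W V ≪≫ₗ (LinearEquiv.refl K (A ⊗[K] W)).prodCongr σ) fun t => ?_
  induction t using TensorProduct.induction_on with
  | zero => simp
  | add t t' ht ht' => simp only [map_add, ht, ht']
  | tmul a z =>
    change (TensorProduct.prodRight K K A W V ≪≫ₗ (LinearEquiv.refl K (A ⊗[K] W)).prodCongr σ)
      (A.d a ⊗ₜ z + A.sgn a ⊗ₜ g.cone.d z) = _
    obtain ⟨y, x⟩ := z
    have hσ : ∀ a, LinearEquiv.ofInvolutive A.sgn sgn_sgn a = A.sgn a := fun _ => rfl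
    simp [σ, hσ, tensorDifferential_tmul, TensorProduct.tmul_add, TensorProduct.tmul_neg,
      TensorProduct.neg_tmul, sgn_sgn, sgn_d, add_comm, add_left_comm]

theorem Hom.IsQuasiIso.tensor {A' B' : DGMod.{u, v} K} {f : Hom A A'} {g : Hom B B'}
    [Module.Projective K B] [Module.Projective K B'] (hf : f.IsQuasiIso) (hg : g.IsQuasiIso) :
    (f.tensor g).IsQuasiIso := by
  have hfg : f.tensor g = ((Hom.id A').tensor g).comp (f.tensor (Hom.id B)) :=
    Hom.ext_toLin (TensorProduct.ext' fun _ _ => rfl)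
  rw [hfg]
  exact hg.id_tensor.comp hf.tensor_id

end DGMod

/-! ### Iterated tensor products -/

theorem sum_Iio_succ {s : ℕ} (i : Fin s) (e : Fin (s + 1) → ℕ) :
    ∑ j ∈ Finset.Iio i.succ, e j = e 0 + ∑ j ∈ Finset.Iio i, e j.succ := by
  have sum_Iio_eq : ∀ {n : ℕ} (i : Fin n) (e : Fin n → ℕ),
      ∑ j ∈ Finset.Iio i, e j = ∑ j, if j < i then e j else 0 := fun i e => by
    rw [← Finset.sum_filter]; congr 1; ext; simp
  rw [sum_Iio_eq, sum_Iio_eq, Fin.sum_univ_succ]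
  simp

namespace DGMod

variable {A A' B B' : DGMod.{u, v} K}

section GroundRing

theorem IsGroundRing.d_eq_zero (hB : B.IsGroundRing) (x : B) : B.d x = 0 := by
  obtain ⟨b, hb, hbij⟩ := hB
  obtain ⟨c, rfl⟩ := hbij.2 x
  simp [B.d_zero b hb]

theorem bijective_tmul_of_bijective_smul {X Y : Type*} [AddCommGroup X] [Module K X]
    [AddCommGroup Y] [Module K Y] {y : Y} (hy : Function.Bijective fun c : K => c • y) :
    Function.Bijective fun x : X => x ⊗ₜ[K] y := by
  let e : K ≃ₗ[K] Y := LinearEquiv.ofBijective (LinearMap.toSpanSingleton K Y y) hy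
  have tmul_eq : (fun x : X => x ⊗ₜ[K] y) = (TensorProduct.rid K X).symm ≪≫ₗ e.lTensor X := by
    ext x
    have e_one : e 1 = y := one_smul K y
    simp [e_one]
  rw [tmul_eq]
  exact LinearEquiv.bijective _

theorem Hom.IsQuasiIso.of_tensor_groundRing {f : Hom A A'} {g : Hom B B'} (hB : B.IsGroundRing)
    (hB' : B'.IsGroundRing) (hg : g.IsQuasiIso) (h : (f.tensor g).IsQuasiIso) : f.IsQuasiIso := by
  have bijective_g := hg.bijective_of_d_eq_zero hB.d_eq_zero hB'.d_eq_zero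
  have ⟨b, _, hb⟩ := hB
  have bijective_smul_gb : Function.Bijective fun c : K => c • g b := by
    convert bijective_g.comp hb using 2 with c
    exact (map_smul g.toLin c b).symm
  refine (isQuasiIso_iff_of_bijective_square (f' := f.tensor g) ((TensorProduct.mk K A B).flip b)
    ((TensorProduct.mk K A' B').flip (g b)) (bijective_tmul_of_bijective_smul hb)
    (bijective_tmul_of_bijective_smul bijective_smul_gb)
    (fun x => ?_) (fun x => ?_) fun x => ?_).2 h
  · simp [tensorDifferential_tmul, hB.d_eq_zero]
  · simp [tensorDifferential_tmul, hB'.d_eq_zero]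
  · simp

end GroundRing

section IteratedTensor

/-- The iterated tensor product `A ⊗ B_1 ⊗ ⋯ ⊗ B_s`, bracketed to the left. -/
noncomputable def iteratedTensor :
    (s : ℕ) → DGMod.{u, v} K → (Fin s → DGMod.{u, v} K) → DGMod.{u, v} K
  | 0, A, _ => A
  | s + 1, A, B => iteratedTensor s (A.tensor (B 0)) fun i => B i.succ

/-- The tensor `a ⊗ b_1 ⊗ ⋯ ⊗ b_s`, as a function of its entries. -/
noncomputable def iteratedTmul : (s : ℕ) → (A : DGMod.{u, v} K) → (B : Fin s → DGMod.{u, v} K) →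
    A →ₗ[K] MultilinearMap K (fun i => (B i : Type v)) (iteratedTensor s A B)
  | 0, A, _ =>
    { toFun := fun a => MultilinearMap.constOfIsEmpty K _ (a : A)
      map_add' := fun _ _ => rfl
      map_smul' := fun _ _ => rfl }
  | s + 1, A, B => (multilinearCurryLeftEquiv K (fun i => (B i : Type v)) _).symm.toLinearMap ∘ₗ
      (TensorProduct.mk K A (B 0)).compr₂ (iteratedTmul s (A.tensor (B 0)) fun i => B i.succ)

theorem iteratedTmul_succ {s : ℕ} (B : Fin (s + 1) → DGMod.{u, v} K) (a : A) (b : ∀ i, B i) :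
    iteratedTmul (s + 1) A B a b =
      iteratedTmul s (A.tensor (B 0)) (fun i => B i.succ) (a ⊗ₜ b 0) (Fin.tail b) :=
  rfl

/-- The linear map on an iterated tensor product which a multilinear map determines. -/
noncomputable def iteratedLift {W : Type*} [AddCommGroup W] [Module K W] :
    (s : ℕ) → (A : DGMod.{u, v} K) → (B : Fin s → DGMod.{u, v} K) →
    (A →ₗ[K] MultilinearMap K (fun i => (B i : Type v)) W) → iteratedTensor s A B →ₗ[K] W
  | 0, A, _, Φ =>
    ({ toFun := fun a => Φ a fun i => i.elim0
       map_add' := fun a a' => by rw [map_add]; rfl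
       map_smul' := fun c a => by rw [map_smul]; rfl } : A →ₗ[K] W)
  | s + 1, A, B, Φ => iteratedLift s (A.tensor (B 0)) (fun i => B i.succ) <| TensorProduct.lift <|
      (multilinearCurryLeftEquiv K (fun i => (B i : Type v)) W).toLinearMap ∘ₗ Φ

theorem iteratedLift_iteratedTmul {W : Type*} [AddCommGroup W] [Module K W] {s : ℕ}
    (A : DGMod.{u, v} K) (B : Fin s → DGMod.{u, v} K)
    (Φ : A →ₗ[K] MultilinearMap K (fun i => (B i : Type v)) W) (a : A) (b : ∀ i, B i) :
    iteratedLift s A B Φ (iteratedTmul s A B a b) = Φ a b := by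
  induction s generalizing A with
  | zero => exact congrArg (Φ a) (Subsingleton.elim (fun i => i.elim0) b)
  | succ s ih =>
    rw [iteratedTmul_succ]
    exact (ih (A.tensor (B 0)) _ _ _ _).trans (congrArg (Φ a) (Fin.cons_self_tail b))

theorem span_iteratedTmul {s : ℕ} (A : DGMod.{u, v} K) (B : Fin s → DGMod.{u, v} K) (S : Set A)
    (hS : Submodule.span K S = ⊤) :
    Submodule.span K {x | ∃ a ∈ S, ∃ b : ∀ i, B i, (∃ e : Fin s → ℕ, ∀ i, b i ∈ (B i).gr (e i)) ∧
      x = iteratedTmul s A B a b} = ⊤ := by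
  induction s generalizing A with
  | zero =>
    rw [eq_top_iff]
    refine hS.symm.le.trans (Submodule.span_mono fun a ha => ?_)
    exact ⟨a, ha, fun i => i.elim0, ⟨Fin.elim0, fun i => i.elim0⟩, rfl⟩
  | succ s ih =>
    have span_tensor : Submodule.span K (Set.image2 (fun a b => (a ⊗ₜ[K] b : A ⊗[K] B 0)) S
        {x | ∃ k, x ∈ (B 0).gr k}) = ⊤ := by
      have h := Submodule.map₂_span_span K (TensorProduct.mk K A (B 0)) S {x | ∃ k, x ∈ (B 0).gr k}
      rw [hS, (B 0).span_homogeneous, TensorProduct.map₂_mk_top_top_eq_top] at h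
      exact h.symm
    refine eq_top_iff.2 ((ih (A.tensor (B 0)) (fun i => B i.succ) _ span_tensor).symm.le.trans
      (Submodule.span_mono ?_))
    rintro _ ⟨_, ⟨a, ha, b₀, ⟨k, hk⟩, rfl⟩, b, ⟨e, he⟩, rfl⟩
    exact ⟨a, ha, (Fin.cons b₀ b : ∀ i, B i), ⟨Fin.cons k e, Fin.cases hk he⟩, rfl⟩

theorem iteratedTensor_d_iteratedTmul {s : ℕ} (A : DGMod.{u, v} K) (B : Fin s → DGMod.{u, v} K)
    (α : ℕ) (e : Fin s → ℕ) (a : A) (b : ∀ i, B i)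
    (ha : a ∈ A.gr α) (hb : ∀ i, b i ∈ (B i).gr (e i)) :
    (iteratedTensor s A B).d (iteratedTmul s A B a b) = iteratedTmul s A B (A.d a) b +
      ∑ i, (-1 : K) ^ (α + ∑ j ∈ Finset.Iio i, e j) •
        iteratedTmul s A B a (Function.update b i ((B i).d (b i))) := by
  induction s generalizing A α with
  | zero =>
    rw [Fin.sum_univ_zero, add_zero]
    rfl
  | succ s ih =>
    have d_tmul : (A.tensor (B 0)).d (a ⊗ₜ b 0) =
        A.d a ⊗ₜ b 0 + (-1 : K) ^ α • (a ⊗ₜ[K] (B 0).d (b 0)) := by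
      rw [tensor_d_tmul, sgn_of_mem ha, TensorProduct.smul_tmul']
    rw [iteratedTmul_succ]
    refine (ih (A.tensor (B 0)) (fun i => B i.succ) (α + e 0) (fun i => e i.succ) (a ⊗ₜ b 0)
      (Fin.tail b) (tmul_mem_tensorGr ha (hb 0)) fun i => hb i.succ).trans ?_
    rw [d_tmul, map_add, map_smul, Fin.sum_univ_succ]
    simp only [iteratedTmul_succ, add_apply, smul_apply, sum_Iio_succ, ← add_assoc,
      Fin.tail_update_zero, Fin.tail_update_succ, Function.update_self]
    have update_zero : ∀ (i : Fin s) (y : B i.succ), Function.update b i.succ y 0 = b 0 :=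
      fun i y => Function.update_of_ne (Fin.succ_ne_zero i).symm y b
    have Iio_zero : Finset.Iio (0 : Fin (s + 1)) = ∅ := by ext; simp
    simp only [update_zero, Iio_zero, Finset.sum_empty, add_zero, Fin.tail]
    exact add_assoc _ _ _

/-- The iterated tensor product of morphisms. -/
noncomputable def Hom.iteratedTensor : (s : ℕ) → {A A' : DGMod.{u, v} K} →
    {B B' : Fin s → DGMod.{u, v} K} → Hom A A' → (∀ i, Hom (B i) (B' i)) →
    Hom (DGMod.iteratedTensor s A B) (DGMod.iteratedTensor s A' B')
  | 0, _, _, _, _, f, _ => f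
  | s + 1, _, _, _, _, f, g => Hom.iteratedTensor s (f.tensor (g 0)) fun i => g i.succ

variable {s : ℕ} {B B' : Fin s → DGMod.{u, v} K} {f : Hom A A'} {g : ∀ i, Hom (B i) (B' i)}

theorem Hom.iteratedTensor_iteratedTmul (f : Hom A A') (g : ∀ i, Hom (B i) (B' i)) (a : A)
    (b : ∀ i, B i) : Hom.iteratedTensor s f g (iteratedTmul s A B a b) =
      iteratedTmul s A' B' (f a) fun i => g i (b i) := by
  induction s generalizing A A' with
  | zero => rfl
  | succ s ih => exact ih _ _ _ _

theorem Hom.IsQuasiIso.iteratedTensor (hB : ∀ i, Module.Projective K (B i))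
    (hB' : ∀ i, Module.Projective K (B' i)) (hf : f.IsQuasiIso) (hg : ∀ i, (g i).IsQuasiIso) :
    (Hom.iteratedTensor s f g).IsQuasiIso := by
  induction s generalizing A A' with
  | zero => exact hf
  | succ s ih =>
    have := hB 0
    have := hB' 0
    exact ih (fun i => hB i.succ) (fun i => hB' i.succ) (hf.tensor (hg 0)) fun i => hg i.succ

theorem Hom.IsQuasiIso.of_iteratedTensor (hB : ∀ i, (B i).IsGroundRing)
    (hB' : ∀ i, (B' i).IsGroundRing) (hg : ∀ i, (g i).IsQuasiIso)
    (h : (Hom.iteratedTensor s f g).IsQuasiIso) : f.IsQuasiIso := by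
  induction s generalizing A A' with
  | zero => exact h
  | succ s ih =>
    exact .of_tensor_groundRing (hB 0) (hB' 0) (hg 0)
      (ih (fun i => hB i.succ) (fun i => hB' i.succ) (fun i => hg i.succ) h)

end IteratedTensor

end DGMod

/-! ### Koszul signs -/

theorem koszulSign_congr {r s : ℕ} (w : Fin r ≃ Fin s) {e e' : Fin s → ℕ}
    (h : ∀ i, e i % 2 = e' i % 2) : koszulSign K w e = koszulSign K w e' := by
  have pow_congr : ∀ i j, (-1 : K) ^ (e i * e j) = (-1) ^ (e' i * e' j) := fun i j => by
    rw [neg_one_pow_eq_pow_mod_two, neg_one_pow_eq_pow_mod_two (n := e' i * e' j), Nat.mul_mod,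
      h, h, ← Nat.mul_mod]
  simp only [koszulSign, pow_congr]

theorem koszulSign_refl {r : ℕ} (e : Fin r → ℕ) : koszulSign K (Equiv.refl (Fin r)) e = 1 :=
  Finset.prod_eq_one fun _ _ => Finset.prod_eq_one fun _ _ =>
    if_neg fun h => lt_asymm h.1 h.2

theorem prod_lt_comp_equiv {q r : ℕ} (σ : Fin q ≃ Fin r) (F : Fin r → Fin r → K)
    (hF : ∀ a b, F a b = F b a) :
    ∏ i, ∏ j, (if i < j then F (σ i) (σ j) else 1) = ∏ a, ∏ b, if a < b then F a b else 1 := by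
  have reindex : ∏ i, ∏ j, (if i < j then F (σ i) (σ j) else 1) =
      ∏ a, ∏ b, if σ.symm a < σ.symm b then F a b else 1 := by
    rw [← Equiv.prod_comp σ]
    refine Finset.prod_congr rfl fun i _ => ?_
    rw [← Equiv.prod_comp σ]
    simp only [Equiv.symm_apply_apply]
  have split_by_order : ∀ a b, (if σ.symm a < σ.symm b then F a b else 1) =
      (if a < b ∧ σ.symm a < σ.symm b then F a b else 1) *
        if b < a ∧ σ.symm a < σ.symm b then F a b else 1 := by
    intro a b
    rcases lt_trichotomy a b with h | rfl | h
    · simp [h, h.not_gt]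
    · simp
    · simp [h, h.not_gt]
  have split_by_image : ∀ a b, (if a < b then F a b else 1) =
      (if a < b ∧ σ.symm a < σ.symm b then F a b else 1) *
        if a < b ∧ σ.symm b < σ.symm a then F b a else 1 := by
    intro a b
    rw [hF b a]
    rcases lt_trichotomy (σ.symm a) (σ.symm b) with h | h | h
    · simp [h, h.not_gt]
    · simp [σ.symm.injective h]
    · simp [h, h.not_gt]
  simp only [reindex, split_by_order, split_by_image, Finset.prod_mul_distrib]
  rw [Finset.prod_comm (f := fun a b => if b < a ∧ σ.symm a < σ.symm b then F a b else 1)]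

theorem koszulSign_trans {q r s : ℕ} (w : Fin q ≃ Fin r) (w' : Fin r ≃ Fin s) (e : Fin s → ℕ) :
    koszulSign K (w.trans w') e = koszulSign K w' e * koszulSign K w (fun i => e (w' i)) := by
  let t : Fin r → Fin r → K := fun a b => (-1) ^ (e (w' a) * e (w' b))
  have t_mul_t : ∀ a b, t a b * t a b = 1 := fun a b => by simp only [t, ← mul_pow]; simp
  have t_symm : ∀ a b, t a b = t b a := fun a b => by simp only [t, mul_comm]
  let inversionSign : Fin r → Fin r → K := fun a b =>
    if (a < b ∧ w' b < w' a) ∨ (b < a ∧ w' a < w' b) then t a b else 1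
  have sign_w' : koszulSign K w' e = ∏ a, ∏ b, if a < b then inversionSign a b else 1 := by
    refine Finset.prod_congr rfl fun a _ => Finset.prod_congr rfl fun b _ => ?_
    by_cases h : a < b
    · simp [inversionSign, t, h, h.not_gt]
    · simp [h]
  rw [sign_w', ← prod_lt_comp_equiv w inversionSign fun a b => by
    simp only [inversionSign, t_symm a b, or_comm]]
  simp only [koszulSign, ← Finset.prod_mul_distrib]
  refine Finset.prod_congr rfl fun i _ => Finset.prod_congr rfl fun j _ => ?_
  by_cases hij : i < j
  · simp only [hij, true_and, Equiv.trans_apply, if_true, inversionSign]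
    change (if _ then t (w i) (w j) else 1) = _ * if _ then t (w i) (w j) else 1
    rcases lt_trichotomy (w i) (w j) with h | h | h
    · simp [h, h.not_gt]
    · exact absurd (w.injective h) hij.ne
    · rcases lt_trichotomy (w' (w i)) (w' (w j)) with h' | h' | h'
      · simp [h, h.not_gt, h', h'.not_gt, t_mul_t]
      · exact absurd (w.injective (w'.injective h')) hij.ne
      · simp [h, h.not_gt, h', h'.not_gt]
  · simp [hij]

/-- The projection of a dg-module onto the sum of its components of degree `≡ ε` modulo `2`. -/
noncomputable def DGMod.parityProj (V : DGMod.{u, v} K) (ε : Fin 2) : V →ₗ[K] V :=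
  V.piecewise fun k => if k % 2 = ε then LinearMap.id else 0

theorem DGMod.parityProj_of_mem {V : DGMod.{u, v} K} {k : ℕ} {x : V} (hx : x ∈ V.gr k)
    (ε : Fin 2) : V.parityProj ε x = if k % 2 = ε then x else 0 := by
  rw [parityProj, piecewise_of_mem _ hx]
  split_ifs <;> rfl

section KoszulTwist

variable {r s : ℕ} (w : Fin s ≃ Fin r) (V : Fin r → DGMod.{u, v} K) {W : Type*} [AddCommGroup W]
  [Module K W]

/-- The multilinear map `(y_1, …, y_r) ↦ ± Φ(y_{w(1)}, …, y_{w(s)})` with the Koszul sign of `w`.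
The sign depends only on the parities of the degrees of the `y_j`. -/
noncomputable def koszulTwist : MultilinearMap K (fun i => (V (w i) : Type v)) W →ₗ[K]
    MultilinearMap K (fun j => (V j : Type v)) W where
  toFun Φ := ∑ ε : Fin r → Fin 2, koszulSign K w (fun j => ε j) •
    ((MultilinearMap.domDomCongrLinearEquiv' K K (fun j => (V j : Type v)) W w.symm).symm
      Φ).compLinearMap fun j => (V j).parityProj (ε j)
  map_add' Φ Φ' := by
    ext y
    simp [Finset.sum_add_distrib]
  map_smul' c Φ := by
    ext y
    simp [Finset.smul_sum, smul_comm c]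

theorem koszulTwist_apply (Φ : MultilinearMap K (fun i => (V (w i) : Type v)) W) (e : Fin r → ℕ)
    (y : ∀ j, V j) (hy : ∀ j, y j ∈ (V j).gr (e j)) :
    koszulTwist w V Φ y = koszulSign K w e • Φ (fun i => y (w i)) := by
  simp only [koszulTwist, LinearMap.coe_mk, AddHom.coe_mk, sum_apply,
    smul_apply, MultilinearMap.compLinearMap_apply]
  let parity : Fin r → Fin 2 := fun j => ⟨e j % 2, Nat.mod_lt _ two_pos⟩
  rw [Finset.sum_eq_single parity]
  · have parityProj_y : ∀ j, (V j).parityProj (parity j) (y j) = y j := fun j => by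
      rw [DGMod.parityProj_of_mem (hy j), if_pos rfl]
    simp only [parityProj_y]
    congr 1
    exact koszulSign_congr w fun j => by simp [parity]
  · intro ε _ hε
    obtain ⟨j, hj⟩ := Function.ne_iff.1 hε
    rw [MultilinearMap.map_coord_zero _ j, smul_zero]
    rw [DGMod.parityProj_of_mem (hy j), if_neg fun h => hj (Fin.ext h.symm)]
  · simp

end KoszulTwist

/-! ### Multilinear maps and submodules -/

section Multilinear

variable {ι : Type*} [Finite ι] {M : ι → Type*} [∀ i, AddCommGroup (M i)] [∀ i, Module K (M i)]
  {W : Type*} [AddCommGroup W] [Module K W]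

theorem multilinear_mem_of_mem_span (f : MultilinearMap K M W) (S : ∀ i, Set (M i))
    (G : Submodule K W) (h : ∀ y, (∀ i, y i ∈ S i) → f y ∈ G) (y : ∀ i, M i)
    (hy : ∀ i, y i ∈ Submodule.span K (S i)) : f y ∈ G := by
  classical
  have := Fintype.ofFinite ι
  suffices partial_span : ∀ (T : Finset ι) (y : ∀ i, M i),
      (∀ i ∈ T, y i ∈ Submodule.span K (S i)) → (∀ i ∉ T, y i ∈ S i) → f y ∈ G from
    partial_span Finset.univ y (fun i _ => hy i) fun i hi => absurd (Finset.mem_univ i) hi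
  intro T
  induction T using Finset.induction_on with
  | empty => exact fun y _ hy => h y fun i => hy i (Finset.notMem_empty i)
  | insert i T hi ih =>
    intro y hspan hS
    have span_le : Submodule.span K (S i) ≤ G.comap (f.toLinearMap y i) := by
      refine Submodule.span_le.2 fun x hx => ih _ (fun j hj => ?_) fun j hj => ?_
      · rw [Function.update_of_ne (ne_of_mem_of_not_mem hj hi)]
        exact hspan j (Finset.mem_insert_of_mem hj)
      · by_cases hji : j = i
        · subst hji; rwa [Function.update_self]
        · rw [Function.update_of_ne hji]
          exact hS j (by simp [hji, hj])
    have mem := span_le (hspan i (Finset.mem_insert_self i T))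
    rwa [Submodule.mem_comap, MultilinearMap.toLinearMap_apply, Function.update_eq_self] at mem

theorem multilinear_sub_mem (f : MultilinearMap K M W) (D : ∀ i, Submodule K (M i))
    (G : Submodule K W) (h : ∀ y i, y i ∈ D i → f y ∈ G) (y y' : ∀ i, M i)
    (hy : ∀ i, y i - y' i ∈ D i) : f y - f y' ∈ G := by
  classical
  have := Fintype.ofFinite ι
  suffices partial_replacement : ∀ T : Finset ι, f (T.piecewise y y') - f y' ∈ G by
    simpa using partial_replacement Finset.univ
  intro T
  induction T using Finset.induction_on with
  | empty => simp
  | insert i T hi ih =>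
    have split_entry : y i = (y i - y' i) + T.piecewise y y' i := by
      rw [Finset.piecewise_eq_of_notMem _ _ _ hi, sub_add_cancel]
    have replace_entry : f (Finset.piecewise (insert i T) y y') =
        f (Function.update (T.piecewise y y') i (y i - y' i)) + f (T.piecewise y y') := by
      rw [Finset.piecewise_insert]
      nth_rewrite 1 [split_entry]
      rw [f.map_update_add, Function.update_eq_self]
    rw [replace_entry, add_sub_assoc]
    exact add_mem (h _ i (by simpa using hy i)) ih

end Multilinear

/-! ### Ordered partitions -/

theorem exists_eq_comp_finSigmaFinEquiv {r : ℕ} (n : Fin r → ℕ) {X : Fin (∑ i, n i) → Type*}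
    (x : ∀ i (a : Fin (n i)), X (finSigmaFinEquiv ⟨i, a⟩)) :
    ∃ z : ∀ k, X k, x = fun i a => z (finSigmaFinEquiv ⟨i, a⟩) := by
  refine ⟨Equiv.piCongrLeft X finSigmaFinEquiv fun s => x s.1 s.2, ?_⟩
  ext i a
  rw [Equiv.piCongrLeft_apply_apply]

theorem exists_sumEquiv_trans_shuffle_eq {n r : ℕ} (k : Fin r → ℕ) (σ : Fin (∑ i, k i) ≃ Fin n) :
    ∃ (f : Fin n → Fin r) (u : ∀ i, Fin (k i) ≃ Fin (part f i).card),
      (sumEquiv u).trans (shuffle f) = σ := by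
  let f : Fin n → Fin r := fun a => (finSigmaFinEquiv.symm (σ.symm a)).1
  let toPart : ∀ i, Fin (k i) → part f i :=
    fun i c => ⟨σ (finSigmaFinEquiv ⟨i, c⟩), by simp [part, f]⟩
  have bijective_toPart : ∀ i, Function.Bijective (toPart i) := by
    refine fun i => ⟨fun c c' h => by simpa [toPart] using h, ?_⟩
    rintro ⟨a, ha⟩
    obtain rfl : (finSigmaFinEquiv.symm (σ.symm a)).1 = i := by simpa [part, f] using ha
    exact ⟨(finSigmaFinEquiv.symm (σ.symm a)).2, by simp [toPart]⟩
  refine ⟨f, fun i => (Equiv.ofBijective _ (bijective_toPart i)).trans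
    ((part f i).orderIsoOfFin rfl).symm.toEquiv, ?_⟩
  ext x
  obtain ⟨⟨i, a⟩, rfl⟩ := finSigmaFinEquiv.surjective x
  simp [sumEquiv, shuffle, Equiv.sigmaFiberEquiv, toPart]

theorem part_comp_equiv {n r s : ℕ} (w : Fin s ≃ Fin r) {f : Fin n → Fin s} {g : Fin n → Fin r}
    (h : w ∘ f = g) (i : Fin s) : part g (w i) = part f i := by
  subst h; ext; simp [part]

theorem card_part_lt {n s : ℕ} {f : Fin n → Fin s} (hf : Function.Surjective f) (hs : 2 ≤ s)
    (i : Fin s) : (part f i).card < n := by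
  have : Nontrivial (Fin s) := Fin.nontrivial_iff_two_le.2 hs
  obtain ⟨j, hj⟩ := exists_ne i
  obtain ⟨a, rfl⟩ := hf j
  have notMem : a ∉ part f i := by simpa [part] using hj
  simpa using Finset.card_lt_univ_of_notMem notMem

theorem card_part_eq_one {n : ℕ} {f : Fin n → Fin n} (hf : Function.Surjective f) (i : Fin n) :
    (part f i).card = 1 := by
  have hinj : Function.Injective f := Finite.injective_iff_surjective.2 hf
  obtain ⟨a, rfl⟩ := hf i
  rw [Finset.card_eq_one]
  exact ⟨a, by ext b; simp [part, hinj.eq_iff]⟩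

theorem card_part_eq_zero {n s : ℕ} {f : Fin n → Fin s} {i : Fin s} (hi : ∀ a, f a ≠ i) :
    (part f i).card = 0 := by
  simpa [part, Finset.filter_eq_empty_iff] using hi

/-- Two surjections `{1, …, n} → {1, …, s}` are equivalent when they differ by a permutation of
`{1, …, s}`, that is, when they encode the same partition of `{1, …, n}` into `s` parts. -/
def surjectionSetoid (n s : ℕ) : Setoid {f : Fin n → Fin s // Function.Surjective f} where
  r f g := ∃ w : Equiv.Perm (Fin s), w ∘ f.1 = g.1
  iseqv :=
    { refl := fun f => ⟨Equiv.refl _, rfl⟩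
      symm := by
        rintro f g ⟨w, hw⟩
        exact ⟨w.symm, by rw [← hw]; ext; simp⟩
      trans := by
        rintro f g h ⟨w, hw⟩ ⟨w', hw'⟩
        exact ⟨w.trans w', by rw [← hw', ← hw]; rfl⟩ }

/-- The partitions of `{1, …, n}` into `s` non-empty parts. -/
def SetPartition (n s : ℕ) : Type := Quotient (surjectionSetoid n s)

namespace SetPartition

variable {n s : ℕ}

noncomputable instance : Fintype (SetPartition n s) :=
  letI : Finite (SetPartition n s) := inferInstanceAs (Finite (Quotient _))
  Fintype.ofFinite _

/-- A chosen ordering of the parts. -/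
noncomputable def rep (z : SetPartition n s) : Fin n → Fin s := (Quotient.out z).1

theorem rep_surjective (z : SetPartition n s) : Function.Surjective z.rep := (Quotient.out z).2

theorem exists_comp_rep_eq {g : Fin n → Fin s} (hg : Function.Surjective g) :
    ∃ (z : SetPartition n s) (w : Equiv.Perm (Fin s)), w ∘ z.rep = g :=
  ⟨Quotient.mk _ ⟨g, hg⟩, Quotient.mk_out (s := surjectionSetoid n s) ⟨g, hg⟩⟩

theorem eq_of_comp_rep_eq {z z' : SetPartition n s} (h : ∃ w : Fin s ≃ Fin s, w ∘ z.rep = z'.rep) :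
    z = z' := by
  rw [← Quotient.out_eq z, ← Quotient.out_eq z']
  exact Quotient.sound (s := surjectionSetoid n s) h

end SetPartition

/-! ### The filtration by the arity of operations -/

theorem SymMod.map_symm_map (M : SymMod.{u, v} K) {m n : ℕ} (σ : Fin m ≃ Fin n) (x : M m) :
    M.map σ.symm (M.map σ x) = x := by
  rw [← M.map_trans, Equiv.self_trans_symm, M.map_refl]

theorem SymMod.map_map_symm (M : SymMod.{u, v} K) {m n : ℕ} (σ : Fin m ≃ Fin n) (x : M n) :
    M.map σ (M.map σ.symm x) = x :=
  M.map_symm_map σ.symm x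

theorem PreComposite.hom_ext {M N : SymMod.{u, v} K} {n : ℕ} {W : Type*} [AddCommGroup W]
    [Module K W] {F G : PreComposite M N n →ₗ[K] W}
    (h : ∀ {r : ℕ} (f : Fin n → Fin r) (p : M r) (y : ∀ i, N (part f i).card),
      F (PreComposite.of M N f p y) = G (PreComposite.of M N f p y)) : F = G := by
  let := Classical.decEq (Σ r : ℕ, (Fin n → Fin r))
  refine DirectSum.linearMap_ext K fun ⟨r, f⟩ => TensorProduct.ext' fun p t => ?_
  refine LinearMap.congr_fun (f := (F ∘ₗ DirectSum.lof K _ _ ⟨r, f⟩) ∘ₗ TensorProduct.mk K _ _ p)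
    (g := (G ∘ₗ DirectSum.lof K _ _ ⟨r, f⟩) ∘ₗ TensorProduct.mk K _ _ p) ?_ t
  exact PiTensorProduct.ext (MultilinearMap.ext fun y => h f p y)

namespace LeftModule

variable {P : Operad.{u, v} K} (R : LeftModule P)

/-- The multilinear map `(y_1, …, y_r) ↦ σ p(y_1, …, y_r)`: the action followed by a
relabelling of the entries. -/
noncomputable def relabelledAct {n r : ℕ} (k : Fin r → ℕ) (σ : Fin (∑ i, k i) ≃ Fin n) :
    P.obj r →ₗ[K] MultilinearMap K (fun i => (R.obj (k i) : Type v)) (R.obj n) where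
  toFun p := (R.map σ).toLin.compMultilinearMap (R.act.comp k p)
  map_add' p q := by ext; simp
  map_smul' c p := by ext; simp

@[simp] theorem relabelledAct_apply {n r : ℕ} (k : Fin r → ℕ) (σ : Fin (∑ i, k i) ≃ Fin n)
    (p : P.obj r) (y : ∀ i, R.obj (k i)) :
    R.relabelledAct k σ p y = R.map σ (R.act.comp k p y) := rfl

end LeftModule

namespace QuasiFree

variable {P : Operad.{u, v} K} {R : LeftModule P} (F : QuasiFree R)

/-- The submodule of `R(n)` spanned by the composites `p(y_1, …, y_r)` of generators `y_i` with
operations `p` of arity `r ≥ s`, and by their images under permutations. These submodules form a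
decreasing filtration of `R(n)`. -/
def filt (s n : ℕ) : Submodule K (R.obj n) :=
  Submodule.span K {z | ∃ (r : ℕ) (k : Fin r → ℕ) (σ : Fin (∑ i, k i) ≃ Fin n) (a : ℕ)
    (e : Fin r → ℕ) (p : P.obj r) (y : ∀ i, F.gen (k i)),
    s ≤ r ∧ p ∈ (P.obj r).gr a ∧ (∀ i, y i ∈ (F.gen (k i)).gr (e i)) ∧
      z = R.map σ (R.act.comp k p fun i => F.incl _ (y i))}

theorem filt_antitone (n : ℕ) : Antitone fun s => F.filt s n := fun _ _ h =>
  Submodule.span_mono fun _ ⟨r, k, σ, a, e, p, y, hr, H⟩ => ⟨r, k, σ, a, e, p, y, h.trans hr, H⟩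

theorem act_incl_mem_filt {n r : ℕ} (k : Fin r → ℕ) (σ : Fin (∑ i, k i) ≃ Fin n) (p : P.obj r)
    (y : ∀ i, F.gen (k i)) : R.map σ (R.act.comp k p fun i => F.incl _ (y i)) ∈ F.filt r n := by
  induction p using DGMod.homogeneous_induction with
  | zero => simp
  | add p q hp hq =>
    rw [map_add, add_apply, map_add]
    exact add_mem hp hq
  | homogeneous a p hp =>
    refine multilinear_mem_of_mem_span
      ((R.relabelledAct k σ p).compLinearMap fun i => F.incl (k i))
      (fun i => {x | ∃ l, x ∈ (F.gen (k i)).gr l}) _ (fun y hy => ?_) y fun i => ?_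
    · choose e he using hy
      exact Submodule.subset_span ⟨r, k, σ, a, e, p, y, le_rfl, hp, he, rfl⟩
    · rw [DGMod.span_homogeneous]
      exact Submodule.mem_top

theorem act_act_incl_mem_filt {n r : ℕ} (l : Fin r → ℕ) (m : ∀ i, Fin (l i) → ℕ)
    (τ : Fin (∑ i, ∑ a, m i a) ≃ Fin n) (b : Fin r → ℕ) (e : ∀ i, Fin (l i) → ℕ) (p : P.obj r)
    (q : ∀ i, P.obj (l i)) (z : ∀ i a, F.gen (m i a)) (hq : ∀ i, q i ∈ (P.obj (l i)).gr (b i))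
    (hz : ∀ i a, z i a ∈ (F.gen (m i a)).gr (e i a)) :
    R.map τ (R.act.comp (fun i => ∑ a, m i a) p fun i =>
      R.act.comp (m i) (q i) fun a => F.incl _ (z i a)) ∈ F.filt (∑ i, l i) n := by
  obtain ⟨m, rfl⟩ := exists_eq_comp_finSigmaFinEquiv l (X := fun _ => ℕ) m
  obtain ⟨e, rfl⟩ := exists_eq_comp_finSigmaFinEquiv l (X := fun _ => ℕ) e
  obtain ⟨z, rfl⟩ := exists_eq_comp_finSigmaFinEquiv l (X := fun k => F.gen (m k)) z
  have hz' : ∀ k, z k ∈ (F.gen (m k)).gr (e k) := fun k => by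
    obtain ⟨⟨i, a⟩, rfl⟩ := finSigmaFinEquiv.surjective k
    exact hz i a
  have assoc := R.assoc l m b e p q (fun k => F.incl _ (z k)) hq
    fun k => F.incl_mem _ _ _ (hz' k)
  set c := ∑ i, ∑ j ∈ Finset.Iio i, b i * ∑ a, e (finSigmaFinEquiv ⟨j, a⟩)
  have sign_mul_sign : (-1 : K) ^ c * (-1) ^ c = 1 := by rw [← mul_pow]; simp
  have act_act := congrArg
    (fun x => (-1 : K) ^ c • R.map (finCongr (sum_sum_finSigma l m)).symm x) assoc
  simp only [map_smul, smul_smul, sign_mul_sign, one_smul, R.map_symm_map] at act_act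
  rw [← act_act, map_smul, ← R.map_trans]
  exact Submodule.smul_mem _ _ (F.act_incl_mem_filt _ _ _ _)

theorem act_mem_filt_sum {n r : ℕ} (k : Fin r → ℕ) (σ : Fin (∑ i, k i) ≃ Fin n) (t : Fin r → ℕ)
    (p : P.obj r) (y : ∀ i, R.obj (k i)) (hy : ∀ i, y i ∈ F.filt (t i) (k i)) :
    R.map σ (R.act.comp k p y) ∈ F.filt (∑ i, t i) n := by
  refine multilinear_mem_of_mem_span (R.relabelledAct k σ p) _ _ (fun y hy => ?_) y hy
  choose l m τ b e q z hl hq hz hy using hy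
  obtain rfl : y = _ := funext hy
  rw [LeftModule.relabelledAct_apply, R.act.comp_map_inner, ← R.map_trans]
  exact F.filt_antitone n (Finset.sum_le_sum fun i _ => hl i)
    (F.act_act_incl_mem_filt l m _ b e p q z hq hz)

theorem filt_zero (n : ℕ) : F.filt 0 n = ⊤ := by
  have mkQ_preCanonical : (F.filt 0 n).mkQ ∘ₗ preCanonical R F.gen F.incl n = 0 :=
    PreComposite.hom_ext fun f p y => by
      rw [LinearMap.comp_apply, preCanonical_of]
      exact (Submodule.Quotient.mk_eq_zero _).2
        (F.filt_antitone n (Nat.zero_le _) (F.act_incl_mem_filt _ _ _ _))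
  refine eq_top_iff.2 fun x _ => ?_
  obtain ⟨x, rfl⟩ := (F.bijective n).2 x
  obtain ⟨x, rfl⟩ := Submodule.mkQ_surjective _ x
  exact (Submodule.Quotient.mk_eq_zero _).1 (LinearMap.congr_fun mkQ_preCanonical x)

theorem filt_one (hP : Subsingleton (P.obj 0)) (n : ℕ) : F.filt 1 n = ⊤ := by
  rw [eq_top_iff, ← F.filt_zero n]
  refine Submodule.span_le.2 ?_
  rintro _ ⟨r, k, σ, a, e, p, y, -, -, -, rfl⟩
  rcases Nat.eq_zero_or_pos r with rfl | hr
  · simp [Subsingleton.elim p 0]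
  · exact F.filt_antitone n hr (F.act_incl_mem_filt _ _ _ _)

theorem act_mem_filt (hP : Subsingleton (P.obj 0)) {n r : ℕ} (k : Fin r → ℕ)
    (σ : Fin (∑ i, k i) ≃ Fin n) (p : P.obj r) (y : ∀ i, R.obj (k i)) :
    R.map σ (R.act.comp k p y) ∈ F.filt r n := by
  simpa using F.act_mem_filt_sum k σ (fun _ => 1) p y fun i => by simp [F.filt_one hP]

theorem filt_two (hP : Subsingleton (P.obj 0)) (n : ℕ) : F.filt 2 n = R.decomposables n := by
  refine le_antisymm (Submodule.span_le.2 ?_) (Submodule.span_le.2 ?_)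
  · rintro _ ⟨r, k, σ, a, e, p, y, hr, hp, hy, rfl⟩
    exact LeftModule.mem_decomposables σ (by omega) hp fun i => F.incl_mem _ _ _ (hy i)
  · rintro _ ⟨r, k, σ, a, e, p, y, hr, -, -, rfl⟩
    rcases Nat.eq_zero_or_pos r with rfl | hr'
    · simp [Subsingleton.elim p 0]
    · exact F.filt_antitone n (show 2 ≤ r by omega) (F.act_mem_filt hP _ _ _ _)

theorem act_mem_filt_succ (hP : Subsingleton (P.obj 0)) {n r : ℕ} (k : Fin r → ℕ)
    (σ : Fin (∑ i, k i) ≃ Fin n) (p : P.obj r) (y : ∀ i, R.obj (k i)) (j : Fin r)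
    (hj : y j ∈ R.decomposables (k j)) : R.map σ (R.act.comp k p y) ∈ F.filt (r + 1) n := by
  have mem := F.act_mem_filt_sum k σ (Function.update (fun _ => 1) j 2) p y fun i => by
    by_cases h : i = j
    · subst h; rwa [Function.update_self, F.filt_two hP]
    · rw [Function.update_of_ne h, F.filt_one hP]; exact Submodule.mem_top
  have sum_arities : ∑ i, Function.update (fun _ => 1) j 2 i = r + 1 := by
    rw [Finset.sum_update_of_mem (Finset.mem_univ j)]
    have hr := j.pos
    simp only [Finset.sum_const, Finset.card_sdiff, Finset.card_univ, Fintype.card_fin,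
      Finset.inter_univ, Finset.card_singleton, smul_eq_mul, mul_one]
    omega
  rwa [sum_arities] at mem

theorem act_sub_act_mem_filt_succ (hP : Subsingleton (P.obj 0)) {n r : ℕ} (k : Fin r → ℕ)
    (σ : Fin (∑ i, k i) ≃ Fin n) (p : P.obj r) (y y' : ∀ i, R.obj (k i))
    (h : ∀ i, y i - y' i ∈ R.decomposables (k i)) :
    R.map σ (R.act.comp k p y) - R.map σ (R.act.comp k p y') ∈ F.filt (r + 1) n :=
  multilinear_sub_mem (R.relabelledAct k σ p) _ _
    (fun y j hj => F.act_mem_filt_succ hP k σ p y j hj) y y' h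

theorem d_mem_filt (hP : Subsingleton (P.obj 0)) {s n : ℕ} {x : R.obj n} (hx : x ∈ F.filt s n) :
    (R.obj n).d x ∈ F.filt s n := by
  suffices le_comap : F.filt s n ≤ (F.filt s n).comap (R.obj n).d from le_comap hx
  refine Submodule.span_le.2 ?_
  rintro _ ⟨r, k, σ, a, e, p, y, hr, hp, hy, rfl⟩
  change (R.obj n).d _ ∈ F.filt s n
  rw [← (R.map σ).map_d, R.act.d_comp k a e p _ hp fun i => F.incl_mem _ _ _ (hy i), map_add,
    map_sum]
  refine add_mem (F.filt_antitone n hr (F.act_incl_mem_filt _ _ _ _)) (sum_mem fun i _ => ?_)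
  rw [map_smul]
  exact Submodule.smul_mem _ _ (F.filt_antitone n hr (F.act_mem_filt hP _ _ _ _))

theorem filt_eq_bot (h0 : F.gen.IsConnected) {s n : ℕ} (h : n < s) : F.filt s n = ⊥ := by
  refine Submodule.span_eq_bot.2 ?_
  rintro _ ⟨r, k, σ, a, e, p, y, hr, -, -, rfl⟩
  have sum_arities : ∑ i, k i = n := by simpa using Fintype.card_congr σ
  obtain ⟨i, hi⟩ : ∃ i, k i = 0 := by
    by_contra! hne
    have card_le : ∑ _i : Fin r, 1 ≤ ∑ i, k i :=
      Finset.sum_le_sum fun i _ => Nat.one_le_iff_ne_zero.2 (hne i)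
    simp only [Finset.sum_const, Finset.card_univ, Fintype.card_fin, smul_eq_mul, mul_one]
      at card_le
    omega
  have : Subsingleton (F.gen (k i)) := by rw [hi]; exact h0
  rw [MultilinearMap.map_coord_zero _ i, map_zero]
  rw [Subsingleton.elim (y i) 0, map_zero]

end QuasiFree

/-! ### Blocks: the summands of the graded pieces -/

section Block

/-- The dg-module `M(s) ⊗ N(J_1) ⊗ ⋯ ⊗ N(J_s)`, where `J_i = f⁻¹(i)`: the summand of the
composition product `M ∘ N` whose index is the partition encoded by `f`. -/
noncomputable abbrev block (M N : SymMod.{u, v} K) {n s : ℕ} (f : Fin n → Fin s) : DGMod.{u, v} K :=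
  DGMod.iteratedTensor s (M s) fun i => N (part f i).card

/-- The tensor `p ⊗ y_1 ⊗ ⋯ ⊗ y_s` in a block, as a function of its entries. -/
noncomputable abbrev blockTmul (M N : SymMod.{u, v} K) {n s : ℕ} (f : Fin n → Fin s) :
    M s →ₗ[K] MultilinearMap K (fun i => (N (part f i).card : Type v)) (block M N f) :=
  DGMod.iteratedTmul s (M s) fun i => N (part f i).card

variable {M N : SymMod.{u, v} K} {n r s : ℕ}

theorem block_induction {f : Fin n → Fin s} (G : Submodule K (block M N f))
    (h : ∀ (a : ℕ) (e : Fin s → ℕ) (p : M s) (y : ∀ i, N (part f i).card), p ∈ (M s).gr a →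
      (∀ i, y i ∈ (N _).gr (e i)) → blockTmul M N f p y ∈ G) (t : block M N f) : t ∈ G := by
  have mem_span : t ∈ (⊤ : Submodule K (block M N f)) := Submodule.mem_top
  rw [← DGMod.span_iteratedTmul (M s) (fun i => N (part f i).card) _ (M s).span_homogeneous]
    at mem_span
  refine Submodule.span_le.2 ?_ mem_span
  rintro _ ⟨p, ⟨a, hp⟩, y, ⟨e, hy⟩, rfl⟩
  exact h a e p y hp hy

variable (M N)

/-- The map `p ⊗ y_1 ⊗ ⋯ ⊗ y_r ↦ ± w⁻¹(p) ⊗ (y_{w(1)} ⊗ ⋯ ⊗ y_{w(s)})`, which identifies the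
summands of index `g = w ∘ f` and `f` in the composition product. -/
noncomputable def blockTwist (f : Fin n → Fin s) (g : Fin n → Fin r) (w : Fin s ≃ Fin r)
    (hw : w ∘ f = g) :
    M r →ₗ[K] MultilinearMap K (fun j => (N (part g j).card : Type v)) (block M N f) :=
  koszulTwist w (fun j => N (part g j).card) ∘ₗ
    { toFun := fun p => (blockTmul M N f (M.map w.symm p)).compLinearMap fun i =>
        (N.map (finCongr (congrArg Finset.card (part_comp_equiv w hw i)))).toLin
      map_add' := fun p q => by ext; simp
      map_smul' := fun c p => by ext; simp }

variable {M N}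

theorem blockTwist_apply {f : Fin n → Fin s} {g : Fin n → Fin r} (w : Fin s ≃ Fin r)
    (hw : w ∘ f = g) (p : M r) {e : Fin r → ℕ} {y : ∀ j, N (part g j).card}
    (hy : ∀ j, y j ∈ (N _).gr (e j)) :
    blockTwist M N f g w hw p y = koszulSign K w e • blockTmul M N f (M.map w.symm p) fun i =>
      N.map (finCongr (congrArg Finset.card (part_comp_equiv w hw i))) (y (w i)) := by
  rw [blockTwist, LinearMap.comp_apply, koszulTwist_apply w _ _ e y hy]
  rfl

variable (M N) in
open Classical in
/-- The projection of the composition product onto the block of index `f`. It is meaningful for a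
surjection `f`, in which case there is at most one `w` with `w ∘ f` equal to a given map. -/
noncomputable def preBlockProj (f : Fin n → Fin s) : PreComposite M N n →ₗ[K] block M N f :=
  letI := Classical.decEq (Σ r : ℕ, (Fin n → Fin r))
  DirectSum.toModule K _ _ fun x => TensorProduct.lift
    ((PiTensorProduct.lift (R := K)).toLinearMap ∘ₗ
      if h : ∃ w : Fin s ≃ Fin x.1, w ∘ f = x.2 then blockTwist M N f x.2 h.choose h.choose_spec
      else 0)

theorem preBlockProj_of_not_exists (f : Fin n → Fin s) (g : Fin n → Fin r)
    (h : ¬∃ w : Fin s ≃ Fin r, w ∘ f = g) (p : M r) (y : ∀ j, N (part g j).card) :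
    preBlockProj M N f (PreComposite.of M N g p y) = 0 := by
  rw [preBlockProj, PreComposite.of, DirectSum.toModule_lof, dif_neg h]
  simp

theorem preBlockProj_of {f : Fin n → Fin s} (hf : Function.Surjective f) {g : Fin n → Fin r}
    (w : Fin s ≃ Fin r) (hw : w ∘ f = g) (p : M r) {e : Fin r → ℕ} {y : ∀ j, N (part g j).card}
    (hy : ∀ j, y j ∈ (N _).gr (e j)) :
    preBlockProj M N f (PreComposite.of M N g p y) =
      koszulSign K w e • blockTmul M N f (M.map w.symm p) fun i =>
        N.map (finCongr (congrArg Finset.card (part_comp_equiv w hw i))) (y (w i)) := by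
  have h : ∃ w : Fin s ≃ Fin r, w ∘ f = g := ⟨w, hw⟩
  have choose_eq : h.choose = w := by
    ext i
    obtain ⟨a, rfl⟩ := hf i
    exact congrArg Fin.val (congrFun (h.choose_spec.trans hw.symm) a)
  have blockTwist_congr : ∀ (w' : Fin s ≃ Fin r) (hw' : w' ∘ f = g), w' = w →
      blockTwist M N f g w' hw' = blockTwist M N f g w hw := by
    rintro _ _ rfl; rfl
  rw [← blockTwist_apply w hw p hy, ← blockTwist_congr _ h.choose_spec choose_eq, preBlockProj,
    PreComposite.of, DirectSum.toModule_lof, dif_pos h]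
  simp

variable (M N)

theorem compositeRelations_le_ker_preBlockProj {f : Fin n → Fin s} (hf : Function.Surjective f) :
    compositeRelations M N n ≤ LinearMap.ker (preBlockProj M N f) := by
  refine Submodule.span_le.2 ?_
  rintro _ ⟨r, w, g, p, e, y, hy, rfl⟩
  rw [SetLike.mem_coe, LinearMap.mem_ker, map_sub, map_smul, sub_eq_zero]
  by_cases h : ∃ w₀ : Fin s ≃ Fin r, w₀ ∘ f = g
  · obtain ⟨w₀, rfl⟩ := h
    rw [preBlockProj_of hf (w₀.trans w) (by ext; simp) _ hy,
      preBlockProj_of hf w₀ rfl p (e := fun i => e (w i))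
        fun j => (N.map _).map_mem _ _ (hy (w j)), koszulSign_trans, smul_smul]
    congr 2
    · rw [← M.map_trans, show w.trans (w₀.trans w).symm = w₀.symm by ext; simp]
    · ext i
      rw [← N.map_trans]
      rfl
  · rw [preBlockProj_of_not_exists f g h, preBlockProj_of_not_exists f, smul_zero]
    rintro ⟨w₁, hw₁⟩
    refine h ⟨w₁.trans w.symm, ?_⟩
    ext a
    simpa using congrArg Fin.val (congrArg w.symm (congrFun hw₁ a))

/-- The sum of the blocks of `(M ∘ N)(n)` over the partitions into `s` non-empty parts. -/
abbrev Blocks (n s : ℕ) : Type v := ∀ z : SetPartition n s, block M N z.rep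

/-- The differential of the sum of the blocks with `s` parts. -/
noncomputable abbrev blocksDifferential (n s : ℕ) : Blocks M N n s →ₗ[K] Blocks M N n s :=
  LinearMap.piMap fun z => (block M N z.rep).d

end Block

namespace QuasiFree

variable {P : Operad.{u, v} K} {R : LeftModule P} (F : QuasiFree R)

/-- The map `p ⊗ y_1 ⊗ ⋯ ⊗ y_s ↦ p(y_1, …, y_s)`. -/
noncomputable def blockMap {n s : ℕ} (f : Fin n → Fin s) :
    block P.toSymMod F.gen f →ₗ[K] R.obj n :=
  DGMod.iteratedLift s (P.obj s) (fun i => F.gen (part f i).card)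
    { toFun := fun p => (R.relabelledAct _ (shuffle f) p).compLinearMap fun i => F.incl _
      map_add' := fun p q => by ext; simp
      map_smul' := fun c p => by ext; simp }

theorem blockMap_blockTmul {n s : ℕ} (f : Fin n → Fin s) (p : P.obj s)
    (y : ∀ i, F.gen (part f i).card) : F.blockMap f (blockTmul P.toSymMod F.gen f p y) =
      R.map (shuffle f) (R.act.comp _ p fun i => F.incl _ (y i)) :=
  DGMod.iteratedLift_iteratedTmul _ _ _ _ _

theorem blockMap_mem_filt {n s : ℕ} (f : Fin n → Fin s) (t : block P.toSymMod F.gen f) :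
    F.blockMap f t ∈ F.filt s n := by
  refine block_induction ((F.filt s n).comap (F.blockMap f)) (fun a e p y _ _ => ?_) t
  rw [Submodule.mem_comap, F.blockMap_blockTmul]
  exact F.act_incl_mem_filt _ _ _ _

theorem blockMap_d_sub_mem_filt (hP : Subsingleton (P.obj 0)) {n s : ℕ} (f : Fin n → Fin s)
    (t : block P.toSymMod F.gen f) :
    F.blockMap f ((block P.toSymMod F.gen f).d t) - (R.obj n).d (F.blockMap f t) ∈
      F.filt (s + 1) n := by
  refine block_induction ((F.filt (s + 1) n).comap
    (F.blockMap f ∘ₗ (block P.toSymMod F.gen f).d - (R.obj n).d ∘ₗ F.blockMap f))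
    (fun a e p y hp hy => ?_) t
  rw [Submodule.mem_comap, LinearMap.sub_apply, LinearMap.comp_apply, LinearMap.comp_apply,
    F.blockMap_blockTmul, ← (R.map _).map_d,
    R.act.d_comp _ a e p _ hp fun i => F.incl_mem _ _ _ (hy i),
    DGMod.iteratedTensor_d_iteratedTmul (P.obj s) _ a e p y hp hy]
  simp only [map_add, map_sum, map_smul]
  rw [F.blockMap_blockTmul, add_sub_add_left_eq_sub, ← Finset.sum_sub_distrib]
  refine sum_mem fun i _ => ?_
  rw [← smul_sub, F.blockMap_blockTmul]
  refine Submodule.smul_mem _ _ (F.act_sub_act_mem_filt_succ hP _ _ _ _ _ fun j => ?_)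
  by_cases h : j = i
  · subst h
    rw [Function.update_self, Function.update_self, ← neg_sub]
    exact neg_mem (F.twist_mem _ _)
  · rw [Function.update_of_ne h, Function.update_of_ne h, sub_self]
    exact zero_mem _

/-- The isomorphism `P ∘ R̄ ≃ R`. -/
noncomputable def equiv (n : ℕ) : Composite P.toSymMod F.gen n ≃ₗ[K] R.obj n :=
  LinearEquiv.ofBijective _ (F.bijective n)

theorem equiv_mkQ_of {n r : ℕ} (g : Fin n → Fin r) (p : P.obj r)
    (y : ∀ i, F.gen (part g i).card) :
    F.equiv n (Submodule.mkQ _ (PreComposite.of P.toSymMod F.gen g p y)) =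
      R.map (shuffle g) (R.act.comp _ p fun i => F.incl _ (y i)) :=
  preCanonical_of R F.gen F.incl g p y

/-- The projection of `R(n)` onto the block of index `f`. -/
noncomputable def blockProj {n s : ℕ} (f : Fin n → Fin s) (hf : Function.Surjective f) :
    R.obj n →ₗ[K] block P.toSymMod F.gen f :=
  (compositeRelations P.toSymMod F.gen n).liftQ _
    (compositeRelations_le_ker_preBlockProj P.toSymMod F.gen hf) ∘ₗ (F.equiv n).symm.toLinearMap

theorem blockProj_act {n r s : ℕ} {f : Fin n → Fin s} (hf : Function.Surjective f)
    (g : Fin n → Fin r) (p : P.obj r) (y : ∀ i, F.gen (part g i).card) :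
    F.blockProj f hf (R.map (shuffle g) (R.act.comp _ p fun i => F.incl _ (y i))) =
      preBlockProj P.toSymMod F.gen f (PreComposite.of P.toSymMod F.gen g p y) := by
  rw [← F.equiv_mkQ_of, blockProj, LinearMap.comp_apply, LinearEquiv.coe_coe,
    LinearEquiv.symm_apply_apply]
  rfl

theorem exists_act_incl_eq_shuffle {n r : ℕ} (k : Fin r → ℕ) (σ : Fin (∑ i, k i) ≃ Fin n) :
    ∃ (g : Fin n → Fin r) (u : ∀ i, Fin (k i) ≃ Fin (part g i).card), ∀ (p : P.obj r)
      (y : ∀ i, F.gen (k i)), R.map σ (R.act.comp k p fun i => F.incl _ (y i)) =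
        R.map (shuffle g) (R.act.comp _ p fun i => F.incl _ (F.gen.map (u i) (y i))) := by
  obtain ⟨g, u, rfl⟩ := exists_sumEquiv_trans_shuffle_eq k σ
  refine ⟨g, u, fun p y => ?_⟩
  simp only [F.incl_map]
  rw [R.act.comp_map_inner, R.map_trans]

theorem blockProj_eq_zero {n s : ℕ} {f : Fin n → Fin s} (hf : Function.Surjective f) {x : R.obj n}
    (hx : x ∈ F.filt (s + 1) n) : F.blockProj f hf x = 0 := by
  refine (Submodule.span_le.2 ?_ : F.filt (s + 1) n ≤ LinearMap.ker (F.blockProj f hf)) hx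
  rintro _ ⟨r, k, σ, a, e, p, y, hr, -, -, rfl⟩
  obtain ⟨g, u, hg⟩ := F.exists_act_incl_eq_shuffle k σ
  rw [SetLike.mem_coe, LinearMap.mem_ker, hg, F.blockProj_act]
  refine preBlockProj_of_not_exists f g ?_ p _
  rintro ⟨w, -⟩
  have : s = r := by simpa using Fintype.card_congr w
  omega

theorem blockProj_blockMap {n s : ℕ} {f : Fin n → Fin s} (hf : Function.Surjective f)
    (t : block P.toSymMod F.gen f) : F.blockProj f hf (F.blockMap f t) = t := by
  refine block_induction (LinearMap.eqLocus (F.blockProj f hf ∘ₗ F.blockMap f) LinearMap.id)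
    (fun a e p y _ hy => ?_) t
  rw [LinearMap.mem_eqLocus, LinearMap.id_apply, LinearMap.comp_apply, F.blockMap_blockTmul,
    F.blockProj_act, preBlockProj_of hf (g := f) (Equiv.refl _) rfl p hy, koszulSign_refl, one_smul]
  congr 1
  · exact congrArg _ (P.map_refl s p)
  · ext i
    exact F.gen.map_refl _ (y i)

theorem blockProj_blockMap_of_not_exists {n r s : ℕ} {f : Fin n → Fin s}
    (hf : Function.Surjective f) (g : Fin n → Fin r) (h : ¬∃ w : Fin s ≃ Fin r, w ∘ f = g)
    (t : block P.toSymMod F.gen g) : F.blockProj f hf (F.blockMap g t) = 0 := by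
  refine block_induction (LinearMap.ker (F.blockProj f hf ∘ₗ F.blockMap g))
    (fun a e p y _ _ => ?_) t
  rw [LinearMap.mem_ker, LinearMap.comp_apply, F.blockMap_blockTmul, F.blockProj_act,
    preBlockProj_of_not_exists f g h]

theorem exists_blockMap_eq {n s : ℕ} (f : Fin n → Fin s) (w : Equiv.Perm (Fin s)) (p : P.obj s)
    (e : Fin s → ℕ) (y : ∀ i, F.gen (part (w ∘ f) i).card) (hy : ∀ i, y i ∈ (F.gen _).gr (e i)) :
    ∃ t, F.blockMap f t = R.map (shuffle (w ∘ f)) (R.act.comp _ p fun i => F.incl _ (y i)) := by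
  have relation : PreComposite.of P.toSymMod F.gen (w ∘ f) (P.map w (P.map w.symm p)) y -
      koszulSign K w e • PreComposite.of P.toSymMod F.gen f (P.map w.symm p) (fun i =>
        F.gen.map (finCongr (congrArg Finset.card (part_comp w f i))) (y (w i))) ∈
      compositeRelations P.toSymMod F.gen n :=
    Submodule.subset_span ⟨s, w, f, _, e, y, hy, rfl⟩
  have image_relation := congrArg (F.equiv n) ((Submodule.Quotient.mk_eq_zero _).2 relation)
  rw [P.map_map_symm, ← Submodule.mkQ_apply, map_sub, map_sub, map_smul, map_smul, F.equiv_mkQ_of,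
    F.equiv_mkQ_of, map_zero, sub_eq_zero] at image_relation
  exact ⟨koszulSign K w e • blockTmul P.toSymMod F.gen f (P.map w.symm p) _,
    by rw [image_relation, map_smul, F.blockMap_blockTmul]⟩

/-- The map from the sum of the blocks with `s` parts to `R(n)`. -/
noncomputable def ofBlocks (n s : ℕ) : Blocks P.toSymMod F.gen n s →ₗ[K] R.obj n :=
  ∑ z : SetPartition n s, F.blockMap z.rep ∘ₗ LinearMap.proj z

/-- The projection of `R(n)` onto the sum of the blocks with `s` parts. -/
noncomputable def toBlocks (n s : ℕ) : R.obj n →ₗ[K] Blocks P.toSymMod F.gen n s :=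
  LinearMap.pi fun z => F.blockProj z.rep z.rep_surjective

variable {n s : ℕ}

theorem ofBlocks_apply (t : Blocks P.toSymMod F.gen n s) :
    F.ofBlocks n s t = ∑ z : SetPartition n s, F.blockMap z.rep (t z) := by
  simp [ofBlocks]

theorem ofBlocks_mem_filt (t : Blocks P.toSymMod F.gen n s) : F.ofBlocks n s t ∈ F.filt s n := by
  rw [ofBlocks_apply]
  exact sum_mem fun z _ => F.blockMap_mem_filt z.rep (t z)

theorem toBlocks_ofBlocks (t : Blocks P.toSymMod F.gen n s) :
    F.toBlocks n s (F.ofBlocks n s t) = t := by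
  ext z
  change F.blockProj z.rep z.rep_surjective _ = t z
  rw [ofBlocks_apply, map_sum, Finset.sum_eq_single z]
  · exact F.blockProj_blockMap z.rep_surjective _
  · exact fun z' _ hz' => F.blockProj_blockMap_of_not_exists z.rep_surjective _
      (fun h => hz' (SetPartition.eq_of_comp_rep_eq h).symm) _
  · simp

theorem toBlocks_eq_zero {x : R.obj n} (hx : x ∈ F.filt (s + 1) n) : F.toBlocks n s x = 0 :=
  funext fun z => F.blockProj_eq_zero z.rep_surjective hx

theorem toBlocks_eq_of_sub_mem {x y : R.obj n} (h : x - y ∈ F.filt (s + 1) n) :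
    F.toBlocks n s x = F.toBlocks n s y := by
  rw [← sub_eq_zero, ← map_sub, F.toBlocks_eq_zero h]

theorem ofBlocks_d_sub_mem_filt (hP : Subsingleton (P.obj 0)) (t : Blocks P.toSymMod F.gen n s) :
    F.ofBlocks n s (blocksDifferential P.toSymMod F.gen n s t) - (R.obj n).d (F.ofBlocks n s t) ∈
      F.filt (s + 1) n := by
  rw [ofBlocks_apply, ofBlocks_apply, map_sum, ← Finset.sum_sub_distrib]
  exact sum_mem fun z _ => F.blockMap_d_sub_mem_filt hP _ _

theorem act_incl_mem_range_ofBlocks (h0 : F.gen.IsConnected) {k : Fin s → ℕ}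
    (σ : Fin (∑ i, k i) ≃ Fin n) {e : Fin s → ℕ} (p : P.obj s) {y : ∀ i, F.gen (k i)}
    (hy : ∀ i, y i ∈ (F.gen (k i)).gr (e i)) :
    R.map σ (R.act.comp k p fun i => F.incl _ (y i)) ∈ LinearMap.range (F.ofBlocks n s) := by
  classical
  obtain ⟨g, u, hg⟩ := F.exists_act_incl_eq_shuffle k σ
  rw [hg]
  by_cases hs : Function.Surjective g
  · obtain ⟨z, w, rfl⟩ := SetPartition.exists_comp_rep_eq hs
    obtain ⟨t, ht⟩ := F.exists_blockMap_eq z.rep w p e (fun i => F.gen.map (u i) (y i))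
      fun i => (F.gen.map _).map_mem _ _ (hy i)
    refine ⟨Pi.single z t, ?_⟩
    rw [← ht, ofBlocks_apply, Finset.sum_eq_single z]
    · simp
    · intro z' _ hz'
      simp [hz']
    · simp
  · obtain ⟨i, hi⟩ := not_forall.1 hs
    have : Subsingleton (F.gen (part g i).card) := by
      rw [card_part_eq_zero fun a ha => hi ⟨a, ha⟩]
      exact h0
    rw [MultilinearMap.map_coord_zero _ i, map_zero]
    · exact zero_mem _
    · rw [Subsingleton.elim (F.gen.map (u i) (y i)) 0, map_zero]

theorem filt_le_range_ofBlocks_sup (h0 : F.gen.IsConnected) (n s : ℕ) :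
    F.filt s n ≤ LinearMap.range (F.ofBlocks n s) ⊔ F.filt (s + 1) n := by
  refine Submodule.span_le.2 ?_
  rintro _ ⟨r, k, σ, a, e, p, y, hr, -, hy, rfl⟩
  rcases hr.eq_or_lt with rfl | hr
  · exact Submodule.mem_sup_left (F.act_incl_mem_range_ofBlocks h0 σ p hy)
  · exact Submodule.mem_sup_right (F.filt_antitone n hr (F.act_incl_mem_filt _ _ _ _))

theorem sub_ofBlocks_toBlocks_mem_filt (h0 : F.gen.IsConnected) {x : R.obj n}
    (hx : x ∈ F.filt s n) : x - F.ofBlocks n s (F.toBlocks n s x) ∈ F.filt (s + 1) n := by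
  obtain ⟨_, ⟨t, rfl⟩, y, hy, rfl⟩ := Submodule.mem_sup.1 (F.filt_le_range_ofBlocks_sup h0 n s hx)
  rwa [map_add, F.toBlocks_ofBlocks, F.toBlocks_eq_zero hy, add_zero, add_sub_cancel_left]

theorem toBlocks_d (hP : Subsingleton (P.obj 0)) (h0 : F.gen.IsConnected) {x : R.obj n}
    (hx : x ∈ F.filt s n) : F.toBlocks n s ((R.obj n).d x) =
      blocksDifferential P.toSymMod F.gen n s (F.toBlocks n s x) :=
  calc F.toBlocks n s ((R.obj n).d x)
      = F.toBlocks n s ((R.obj n).d (F.ofBlocks n s (F.toBlocks n s x))) := by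
        refine F.toBlocks_eq_of_sub_mem ?_
        rw [← map_sub]
        exact F.d_mem_filt hP (F.sub_ofBlocks_toBlocks_mem_filt h0 hx)
    _ = F.toBlocks n s
          (F.ofBlocks n s (blocksDifferential P.toSymMod F.gen n s (F.toBlocks n s x))) :=
        (F.toBlocks_eq_of_sub_mem (F.ofBlocks_d_sub_mem_filt hP _)).symm
    _ = blocksDifferential P.toSymMod F.gen n s (F.toBlocks n s x) := F.toBlocks_ofBlocks _

theorem shortExactOn_filt (hP : Subsingleton (P.obj 0)) (h0 : F.gen.IsConnected) (n s : ℕ) :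
    ShortExactOn (R.obj n).d (F.filt s n) (F.filt (s + 1) n)
      (blocksDifferential P.toSymMod F.gen n s) (F.toBlocks n s) where
  d_d := (R.obj n).d_d
  d_mem _ hx := F.d_mem_filt hP hx
  map_d _ hx := F.toBlocks_d hP h0 hx
  surj t := ⟨_, F.ofBlocks_mem_filt t, F.toBlocks_ofBlocks t⟩
  inf_ker := by
    refine le_antisymm (fun x ⟨hx, hx0⟩ => ?_) (le_inf (F.filt_antitone n (Nat.le_succ s))
      fun x hx => F.toBlocks_eq_zero hx)
    rw [SetLike.mem_coe, LinearMap.mem_ker] at hx0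
    simpa [hx0] using F.sub_ofBlocks_toBlocks_mem_filt h0 hx

end QuasiFree

/-! ### Generators and indecomposables -/

namespace DGMod

variable {V W : DGMod.{u, v} K}

theorem Hom.mem_gr_of_map_mem {f : Hom V W} (hf : Function.Injective f) {k : ℕ} {x : V}
    (hx : f x ∈ W.gr k) : x ∈ V.gr k := by
  have proj_eq : V.proj k x = x := hf (by rw [f.map_proj, proj_of_mem k hx, if_pos rfl])
  exact proj_eq ▸ V.proj_mem k x

/-- The inverse of a bijective morphism. -/
noncomputable def Hom.inverse (f : Hom V W) (hf : Function.Bijective f) : Hom W V where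
  toLin := (LinearEquiv.ofBijective f.toLin hf).symm
  map_mem k y hy := Hom.mem_gr_of_map_mem hf.1 <| by
    rwa [← LinearEquiv.ofBijective_apply f.toLin (hf := hf), LinearEquiv.coe_coe,
      LinearEquiv.apply_symm_apply]
  map_d y := by
    obtain ⟨x, rfl⟩ := (LinearEquiv.ofBijective f.toLin hf).surjective y
    rw [LinearEquiv.ofBijective_apply, ← f.map_d]
    simp only [← LinearEquiv.ofBijective_apply f.toLin (hf := hf), LinearEquiv.coe_coe,
      LinearEquiv.symm_apply_apply]

theorem Hom.apply_inverse (f : Hom V W) (hf : Function.Bijective f) (y : W) :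
    f (f.inverse hf y) = y :=
  (LinearEquiv.ofBijective f.toLin hf).apply_symm_apply y

end DGMod

namespace QuasiFree

variable {P : Operad.{u, v} K} {R : LeftModule P} (F : QuasiFree R)

/-- The map from the generators to the indecomposables. -/
def toIndecomposables (n : ℕ) : DGMod.Hom (F.gen n) (R.indecomposables n) where
  toLin := (R.decomposables n).mkQ ∘ₗ F.incl n
  map_mem k x hx := ⟨_, F.incl_mem n k x hx, rfl⟩
  map_d x := ((Submodule.Quotient.eq _).2 (F.twist_mem n x)).symm

theorem map_act_one_incl (n : ℕ) (y : F.gen n) :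
    R.map (finCongr (Fin.sum_univ_one fun _ : Fin 1 => n))
      (R.act.comp (fun _ : Fin 1 => n) P.one fun _ => F.incl n y) = F.incl n y := by
  rw [R.one_act n]
  exact R.map_map_symm (finCongr (Fin.sum_univ_one fun _ : Fin 1 => n)) _

theorem blockTmul_one_eq_zero (hP : P.IsConnected) {n : ℕ} {f : Fin n → Fin 1}
    {y : ∀ i, F.gen (part f i).card} (h : blockTmul P.toSymMod F.gen f P.one y = 0) : y 0 = 0 := by
  refine (DGMod.bijective_tmul_of_bijective_smul hP.2).injective ?_
  exact (congrArg (TensorProduct.comm K (P.obj 1) (F.gen (part f 0).card)) h).trans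
    (TensorProduct.zero_tmul _ P.one).symm

theorem injective_toIndecomposables (hP : P.IsConnected) (h0 : F.gen.IsConnected) (n : ℕ) :
    Function.Injective (F.toIndecomposables n) := by
  refine (injective_iff_map_eq_zero (F.toIndecomposables n).toLin).2 fun y hy => ?_
  rcases Nat.eq_zero_or_pos n with rfl | hn
  · exact @Subsingleton.elim _ h0 _ _
  have incl_mem_filt : F.incl n y ∈ F.filt (1 + 1) n := by
    rw [F.filt_two hP.1]
    exact (Submodule.Quotient.mk_eq_zero _).1 hy
  obtain ⟨f, u, hf⟩ := F.exists_act_incl_eq_shuffle (fun _ : Fin 1 => n)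
    (finCongr (Fin.sum_univ_one fun _ : Fin 1 => n))
  have f_surjective : Function.Surjective f := fun i => ⟨⟨0, hn⟩, Subsingleton.elim _ _⟩
  have incl_eq : F.incl n y = F.blockMap f
      (blockTmul P.toSymMod F.gen f P.one fun i => F.gen.map (u i) y) := by
    rw [← F.map_act_one_incl, F.blockMap_blockTmul]
    exact hf P.one fun _ => y
  rw [incl_eq] at incl_mem_filt
  have tmul_eq_zero := F.blockProj_eq_zero f_surjective incl_mem_filt
  rw [F.blockProj_blockMap] at tmul_eq_zero
  rw [← F.gen.map_symm_map (u 0) y, F.blockTmul_one_eq_zero hP tmul_eq_zero, map_zero]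

theorem filt_one_le_range_incl_sup (hP : P.IsConnected) (n : ℕ) :
    F.filt 1 n ≤ LinearMap.range (F.incl n) ⊔ R.decomposables n := by
  refine Submodule.span_le.2 ?_
  rintro _ ⟨r, k, σ, a, e, p, y, -, hp, hy, rfl⟩
  by_cases hr : r = 1
  · subst hr
    obtain ⟨m, rfl⟩ : ∃ m, k = fun _ => m := ⟨k 0, funext fun i => by rw [Subsingleton.elim i 0]⟩
    obtain ⟨z, rfl⟩ : ∃ z, y = fun _ => z := ⟨y 0, funext fun i => by rw [Subsingleton.elim i 0]⟩
    obtain ⟨c, rfl⟩ := hP.2.surjective p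
    refine Submodule.mem_sup_left ⟨c • F.gen.map
      ((finCongr (Fin.sum_univ_one fun _ : Fin 1 => m)).symm.trans σ) z, ?_⟩
    rw [map_smul, F.incl_map, R.map_trans, map_smul, smul_apply, map_smul]
    nth_rw 1 [← F.map_act_one_incl]
    rw [R.map_symm_map]
  · exact Submodule.mem_sup_right (LeftModule.mem_decomposables σ hr hp fun i =>
      F.incl_mem _ _ _ (hy i))

theorem surjective_toIndecomposables (hP : P.IsConnected) (n : ℕ) :
    Function.Surjective (F.toIndecomposables n) := by
  intro x
  obtain ⟨x, rfl⟩ := Submodule.mkQ_surjective _ x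
  have x_mem : x ∈ F.filt 1 n := by simp [F.filt_one hP.1]
  obtain ⟨_, ⟨y, rfl⟩, z, hz, rfl⟩ := Submodule.mem_sup.1 (F.filt_one_le_range_incl_sup hP n x_mem)
  exact ⟨y, (Submodule.Quotient.eq _).2 (by simpa using hz)⟩

theorem bijective_toIndecomposables (hP : P.IsConnected) (h0 : F.gen.IsConnected) (n : ℕ) :
    Function.Bijective (F.toIndecomposables n) :=
  ⟨F.injective_toIndecomposables hP h0 n, F.surjective_toIndecomposables hP n⟩

theorem shortExactOn_indecomposables (hP : Subsingleton (P.obj 0)) (n : ℕ) :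
    ShortExactOn (R.obj n).d (F.filt 1 n) (F.filt 2 n) (R.indecomposables n).d
      (R.decomposables n).mkQ where
  d_d := (R.obj n).d_d
  d_mem _ hx := F.d_mem_filt hP hx
  map_d _ _ := rfl
  surj t := by
    obtain ⟨x, rfl⟩ := Submodule.mkQ_surjective _ t
    exact ⟨x, by simp [F.filt_one hP], rfl⟩
  inf_ker := by
    rw [F.filt_one hP, top_inf_eq, F.filt_two hP]
    exact Submodule.ker_mkQ _

end QuasiFree

/-! ### Morphisms of quasi-free modules -/

namespace QuasiFree

variable {P P' : Operad.{u, v} K} {R : LeftModule P} {R' : LeftModule P'} {φ : Operad.Hom P P'}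
  (ψ : LeftModule.Hom R (R'.restrict φ)) {F : QuasiFree R} {F' : QuasiFree R'}

theorem map_relabelledAct {n r : ℕ} (k : Fin r → ℕ) (σ : Fin (∑ i, k i) ≃ Fin n) (p : P.obj r)
    (y : ∀ i, R.obj (k i)) : ψ.toSymHom.app n (R.map σ (R.act.comp k p y)) =
      R'.map σ (R'.act.comp k (φ.app r p) fun i => ψ.toSymHom.app _ (y i)) := by
  rw [ψ.toSymHom.naturality]
  exact congrArg (R'.map σ) (ψ.map_act k p y)

theorem map_mem_filt (hP' : Subsingleton (P'.obj 0)) {s n : ℕ} {x : R.obj n}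
    (hx : x ∈ F.filt s n) : ψ.toSymHom.app n x ∈ F'.filt s n := by
  suffices le_comap : F.filt s n ≤ (F'.filt s n).comap (ψ.toSymHom.app n).toLin from le_comap hx
  refine Submodule.span_le.2 ?_
  rintro _ ⟨r, k, σ, a, e, p, y, hr, -, -, rfl⟩
  rw [SetLike.mem_coe, Submodule.mem_comap, map_relabelledAct]
  exact F'.filt_antitone n hr (F'.act_mem_filt hP' _ _ _ _)

variable (F F') in
/-- The morphisms of generators `g n` correspond to the morphism of indecomposable quotients
`ψ̄`. -/
def LiftsIndecomposablesMap (g : ∀ n, DGMod.Hom (F.gen n) (F'.gen n)) : Prop :=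
  ∀ n y, F'.toIndecomposables n (g n y) = ψ.indecomposablesMap.app n (F.toIndecomposables n y)

variable (F F') in
theorem exists_liftsIndecomposablesMap (hP' : P'.IsConnected) (h0' : F'.gen.IsConnected) :
    ∃ g, LiftsIndecomposablesMap ψ F F' g :=
  ⟨fun n => ((F'.toIndecomposables n).inverse (F'.bijective_toIndecomposables hP' h0' n)).comp
    ((ψ.indecomposablesMap.app n).comp (F.toIndecomposables n)),
    fun n _ => DGMod.Hom.apply_inverse _ (F'.bijective_toIndecomposables hP' h0' n) _⟩

variable {ψ} {g : ∀ n, DGMod.Hom (F.gen n) (F'.gen n)}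

theorem LiftsIndecomposablesMap.isQuasiIso_iff (hg : LiftsIndecomposablesMap ψ F F' g)
    (hP : P.IsConnected) (hP' : P'.IsConnected) (h0 : F.gen.IsConnected)
    (h0' : F'.gen.IsConnected) (n : ℕ) :
    (g n).IsQuasiIso ↔ (ψ.indecomposablesMap.app n).IsQuasiIso :=
  DGMod.Hom.isQuasiIso_iff_of_bijective_square (F.toIndecomposables n).toLin
    (F'.toIndecomposables n).toLin (F.bijective_toIndecomposables hP h0 n)
    (F'.bijective_toIndecomposables hP' h0' n) (F.toIndecomposables n).map_d
    (F'.toIndecomposables n).map_d (hg n)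

theorem LiftsIndecomposablesMap.map_incl_sub_mem (hg : LiftsIndecomposablesMap ψ F F' g) (n : ℕ)
    (y : F.gen n) : ψ.toSymHom.app n (F.incl n y) - F'.incl n (g n y) ∈ R'.decomposables n :=
  (Submodule.Quotient.eq _).1 (hg n y).symm

variable (φ g) in
/-- The morphism of blocks induced by `φ` and by morphisms of generators. -/
noncomputable def blockHom {n s : ℕ} (f : Fin n → Fin s) :
    DGMod.Hom (block P.toSymMod F.gen f) (block P'.toSymMod F'.gen f) :=
  DGMod.Hom.iteratedTensor s (φ.app s) fun i => g (part f i).card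

variable (φ g) in
/-- The sum of the morphisms of blocks with `s` parts. -/
noncomputable def blocksMap (n s : ℕ) :
    Blocks P.toSymMod F.gen n s →ₗ[K] Blocks P'.toSymMod F'.gen n s :=
  LinearMap.piMap fun z => (blockHom φ g z.rep).toLin

theorem blockHom_blockTmul {n s : ℕ} (f : Fin n → Fin s) (p : P.obj s)
    (y : ∀ i, F.gen (part f i).card) : blockHom φ g f (blockTmul P.toSymMod F.gen f p y) =
      blockTmul P'.toSymMod F'.gen f (φ.app s p) fun i => g _ (y i) :=
  DGMod.Hom.iteratedTensor_iteratedTmul _ _ _ _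

theorem LiftsIndecomposablesMap.map_blockMap_sub_mem_filt (hg : LiftsIndecomposablesMap ψ F F' g)
    (hP' : Subsingleton (P'.obj 0)) {n s : ℕ} (f : Fin n → Fin s)
    (t : block P.toSymMod F.gen f) :
    ψ.toSymHom.app n (F.blockMap f t) - F'.blockMap f (blockHom φ g f t) ∈
      F'.filt (s + 1) n := by
  refine block_induction ((F'.filt (s + 1) n).comap ((ψ.toSymHom.app n).toLin ∘ₗ F.blockMap f -
    F'.blockMap f ∘ₗ (blockHom φ g f).toLin)) (fun a e p y _ _ => ?_) t
  rw [Submodule.mem_comap, LinearMap.sub_apply, LinearMap.comp_apply, LinearMap.comp_apply,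
    blockHom_blockTmul, F.blockMap_blockTmul, F'.blockMap_blockTmul, map_relabelledAct]
  exact F'.act_sub_act_mem_filt_succ hP' _ _ _ _ _ fun i => hg.map_incl_sub_mem _ (y i)

theorem LiftsIndecomposablesMap.toBlocks_map (hg : LiftsIndecomposablesMap ψ F F' g)
    (hP' : Subsingleton (P'.obj 0)) (h0 : F.gen.IsConnected) {n s : ℕ} {x : R.obj n}
    (hx : x ∈ F.filt s n) :
    F'.toBlocks n s (ψ.toSymHom.app n x) = blocksMap φ g n s (F.toBlocks n s x) :=
  calc F'.toBlocks n s (ψ.toSymHom.app n x)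
      = F'.toBlocks n s (ψ.toSymHom.app n (F.ofBlocks n s (F.toBlocks n s x))) := by
        refine F'.toBlocks_eq_of_sub_mem ?_
        rw [← map_sub]
        exact map_mem_filt ψ hP' (F.sub_ofBlocks_toBlocks_mem_filt h0 hx)
    _ = F'.toBlocks n s (F'.ofBlocks n s (blocksMap φ g n s (F.toBlocks n s x))) := by
        refine F'.toBlocks_eq_of_sub_mem ?_
        rw [ofBlocks_apply, ofBlocks_apply, map_sum, ← Finset.sum_sub_distrib]
        exact sum_mem fun z _ => hg.map_blockMap_sub_mem_filt hP' _ _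
    _ = blocksMap φ g n s (F.toBlocks n s x) := F'.toBlocks_ofBlocks _

end QuasiFree

/-! ### Comparison of the filtrations -/

namespace Operad

variable {P P' : Operad.{u, v} K}

theorem Hom.bijective_app_zero (φ : Hom P P') (hP : Subsingleton (P.obj 0))
    (hP' : Subsingleton (P'.obj 0)) : Function.Bijective (φ.app 0) :=
  ⟨fun _ _ _ => hP.elim _ _, fun _ => ⟨0, hP'.elim _ _⟩⟩

theorem Hom.bijective_app_one (φ : Hom P P') (hP : P.IsConnected) (hP' : P'.IsConnected) :
    Function.Bijective (φ.app 1) := by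
  refine (Function.Bijective.of_comp_iff _ hP.2).1 ?_
  convert hP'.2 using 1
  funext c
  rw [Function.comp_apply, map_smul, φ.map_one]

theorem Hom.isQuasiIso_app_of_lt_two (φ : Hom P P') (hP : P.IsConnected) (hP' : P'.IsConnected)
    {n : ℕ} (hn : n < 2) : (φ.app n).IsQuasiIso := by
  interval_cases n
  · exact .of_bijective (φ.bijective_app_zero hP.1 hP'.1)
  · exact .of_bijective (φ.bijective_app_one hP hP')

end Operad

namespace QuasiFree

variable {P P' : Operad.{u, v} K} {R : LeftModule P} {R' : LeftModule P'} {φ : Operad.Hom P P'}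
  {ψ : LeftModule.Hom R (R'.restrict φ)} {F : QuasiFree R} {F' : QuasiFree R'}
  {g : ∀ n, DGMod.Hom (F.gen n) (F'.gen n)}

variable (ψ F F') in
/-- `ψ` restricts to a quasi-isomorphism between the `s`-th steps of the filtrations in arity `n`:
the subcomplex of the cone of `ψ` which they form is acyclic. -/
def FiltIsQuasiIso (s n : ℕ) : Prop :=
  AcyclicOn (coneDifferential (R.obj n).d (R'.obj n).d (ψ.toSymHom.app n).toLin)
    ((F'.filt s n).prod (F.filt s n))

theorem filtIsQuasiIso_one_iff (hP : Subsingleton (P.obj 0)) (hP' : Subsingleton (P'.obj 0))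
    (n : ℕ) : FiltIsQuasiIso ψ F F' 1 n ↔ (ψ.app n).IsQuasiIso := by
  rw [FiltIsQuasiIso, F.filt_one hP, F'.filt_one hP', Submodule.prod_top]
  exact (ψ.toSymHom.app n).isQuasiIso_iff_acyclicOn_cone.symm

theorem filtIsQuasiIso_of_lt (h0 : F.gen.IsConnected) (h0' : F'.gen.IsConnected) {s n : ℕ}
    (h : n < s) : FiltIsQuasiIso ψ F F' s n := by
  rw [FiltIsQuasiIso, F.filt_eq_bot h0 h, F'.filt_eq_bot h0' h, Submodule.prod_bot]
  exact acyclicOn_bot _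

variable (ψ F F') in
theorem shortExactOn_cone_indecomposables (hP : Subsingleton (P.obj 0))
    (hP' : Subsingleton (P'.obj 0)) (n : ℕ) :
    ShortExactOn (coneDifferential (R.obj n).d (R'.obj n).d (ψ.toSymHom.app n).toLin)
      ((F'.filt 1 n).prod (F.filt 1 n)) ((F'.filt 2 n).prod (F.filt 2 n))
      (coneDifferential (R.indecomposables n).d (R'.indecomposables n).d
        (ψ.indecomposablesMap.app n).toLin)
      ((R'.decomposables n).mkQ.prodMap (R.decomposables n).mkQ) :=
  (F.shortExactOn_indecomposables hP n).cone (F'.shortExactOn_indecomposables hP' n)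
    (ψ.toSymHom.app n).map_d (fun _ => map_mem_filt ψ hP') fun _ _ => rfl

theorem LiftsIndecomposablesMap.shortExactOn_cone_filt (hg : LiftsIndecomposablesMap ψ F F' g)
    (hP : Subsingleton (P.obj 0)) (hP' : Subsingleton (P'.obj 0)) (h0 : F.gen.IsConnected)
    (h0' : F'.gen.IsConnected) (n s : ℕ) :
    ShortExactOn (coneDifferential (R.obj n).d (R'.obj n).d (ψ.toSymHom.app n).toLin)
      ((F'.filt s n).prod (F.filt s n)) ((F'.filt (s + 1) n).prod (F.filt (s + 1) n))
      (coneDifferential (blocksDifferential P.toSymMod F.gen n s)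
        (blocksDifferential P'.toSymMod F'.gen n s) (blocksMap φ g n s))
      ((F'.toBlocks n s).prodMap (F.toBlocks n s)) :=
  (F.shortExactOn_filt hP h0 n s).cone (F'.shortExactOn_filt hP' h0' n s)
    (ψ.toSymHom.app n).map_d (fun _ => map_mem_filt ψ hP') fun _ => hg.toBlocks_map hP' h0

theorem acyclicOn_cone_blocksMap_iff (n s : ℕ) :
    AcyclicOn (coneDifferential (blocksDifferential P.toSymMod F.gen n s)
      (blocksDifferential P'.toSymMod F'.gen n s) (blocksMap φ g n s)) ⊤ ↔
      ∀ z : SetPartition n s, (blockHom φ g z.rep).IsQuasiIso := by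
  simp only [DGMod.Hom.isQuasiIso_iff_acyclicOn_cone]
  exact acyclicOn_cone_pi_iff

theorem isQuasiIso_blockHom (hproj : F.gen.IsProjective) (hproj' : F'.gen.IsProjective)
    {n s : ℕ} (hs : 2 ≤ s) (hφ : (φ.app s).IsQuasiIso) (hg : ∀ m < n, (g m).IsQuasiIso)
    (z : SetPartition n s) : (blockHom φ g z.rep).IsQuasiIso :=
  .iteratedTensor (fun _ => hproj _) (fun _ => hproj' _) hφ fun i =>
    hg _ (card_part_lt z.rep_surjective hs i)

theorem LiftsIndecomposablesMap.filtIsQuasiIso_two (hg : LiftsIndecomposablesMap ψ F F' g)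
    (hP : Subsingleton (P.obj 0)) (hP' : Subsingleton (P'.obj 0)) (h0 : F.gen.IsConnected)
    (h0' : F'.gen.IsConnected) (hproj : F.gen.IsProjective) (hproj' : F'.gen.IsProjective)
    (hφ : φ.IsQuasiIso) {n : ℕ} (hgn : ∀ m < n, (g m).IsQuasiIso) :
    FiltIsQuasiIso ψ F F' 2 n := by
  suffices descend : ∀ s ≤ n + 2, 2 ≤ s → FiltIsQuasiIso ψ F F' s n from
    descend 2 (by omega) le_rfl
  intro s hsn
  induction hsn using Nat.decreasingInduction with
  | self => exact fun _ => filtIsQuasiIso_of_lt h0 h0' (by omega)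
  | of_succ s _ ih =>
    exact fun hs => (hg.shortExactOn_cone_filt hP hP' h0 h0' n s).acyclicOn_middle
      (ih (by omega))
      ((acyclicOn_cone_blocksMap_iff n s).2 (isQuasiIso_blockHom hproj hproj' hs (hφ s) hgn))

theorem LiftsIndecomposablesMap.filtIsQuasiIso_of_le (hg : LiftsIndecomposablesMap ψ F F' g)
    (hP : Subsingleton (P.obj 0)) (hP' : Subsingleton (P'.obj 0)) (h0 : F.gen.IsConnected)
    (h0' : F'.gen.IsConnected) (hproj : F.gen.IsProjective) (hproj' : F'.gen.IsProjective)
    {n : ℕ} (hφ : ∀ s < n, (φ.app s).IsQuasiIso) (hgn : ∀ m < n, (g m).IsQuasiIso)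
    (h_two : FiltIsQuasiIso ψ F F' 2 n) {s : ℕ} (hs : 2 ≤ s) (hsn : s ≤ n) :
    FiltIsQuasiIso ψ F F' s n := by
  induction s, hs using Nat.le_induction with
  | base => exact h_two
  | succ s hs ih =>
    exact (hg.shortExactOn_cone_filt hP hP' h0 h0' n s).acyclicOn_left (ih (by omega))
      ((acyclicOn_cone_blocksMap_iff n s).2 (isQuasiIso_blockHom hproj hproj' hs (hφ s hsn) hgn))

theorem LiftsIndecomposablesMap.isQuasiIso_app_of_filt (hg : LiftsIndecomposablesMap ψ F F' g)
    (hP : Subsingleton (P.obj 0)) (hP' : Subsingleton (P'.obj 0)) (h0 : F.gen.IsConnected)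
    (h0' : F'.gen.IsConnected) (h1 : (F.gen 1).IsGroundRing) (h1' : (F'.gen 1).IsGroundRing)
    (hg1 : (g 1).IsQuasiIso) {n : ℕ} (h_filt : FiltIsQuasiIso ψ F F' n n) :
    (φ.app n).IsQuasiIso := by
  have acyclicOn_blocks := (hg.shortExactOn_cone_filt hP hP' h0 h0' n n).acyclicOn_right
    (filtIsQuasiIso_of_lt h0 h0' n.lt_succ_self) h_filt
  obtain ⟨z, -⟩ := SetPartition.exists_comp_rep_eq (Function.surjective_id (α := Fin n))
  have card_eq_one := card_part_eq_one z.rep_surjective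
  exact .of_iteratedTensor (fun i => (card_eq_one i).symm ▸ h1)
    (fun i => (card_eq_one i).symm ▸ h1') (fun i => (card_eq_one i).symm ▸ hg1)
    ((acyclicOn_cone_blocksMap_iff n n).1 acyclicOn_blocks z)

theorem isQuasiIso_of_indecomposablesMap (hP : P.IsConnected) (hP' : P'.IsConnected)
    (h0 : F.gen.IsConnected) (h0' : F'.gen.IsConnected) (hproj : F.gen.IsProjective)
    (hproj' : F'.gen.IsProjective) (hφ : φ.IsQuasiIso) (hψ : ψ.indecomposablesMap.IsQuasiIso) :
    ψ.IsQuasiIso := fun n => by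
  obtain ⟨g, hg⟩ := exists_liftsIndecomposablesMap ψ F F' hP' h0'
  exact (filtIsQuasiIso_one_iff hP.1 hP'.1 n).1 <|
    (shortExactOn_cone_indecomposables ψ F F' hP.1 hP'.1 n).acyclicOn_middle
      (hg.filtIsQuasiIso_two hP.1 hP'.1 h0 h0' hproj hproj' hφ fun m _ =>
        (hg.isQuasiIso_iff hP hP' h0 h0' m).2 (hψ m))
      (DGMod.Hom.isQuasiIso_iff_acyclicOn_cone _ |>.1 (hψ n))

theorem indecomposablesMap_isQuasiIso (hP : P.IsConnected) (hP' : P'.IsConnected)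
    (h0 : F.gen.IsConnected) (h0' : F'.gen.IsConnected) (hproj : F.gen.IsProjective)
    (hproj' : F'.gen.IsProjective) (hφ : φ.IsQuasiIso) (hψ : ψ.IsQuasiIso) :
    ψ.indecomposablesMap.IsQuasiIso := fun n => by
  obtain ⟨g, hg⟩ := exists_liftsIndecomposablesMap ψ F F' hP' h0'
  induction n using Nat.strong_induction_on with
  | _ n ih =>
    exact (DGMod.Hom.isQuasiIso_iff_acyclicOn_cone _).2 <|
      (shortExactOn_cone_indecomposables ψ F F' hP.1 hP'.1 n).acyclicOn_right
        (hg.filtIsQuasiIso_two hP.1 hP'.1 h0 h0' hproj hproj' hφ fun m hm =>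
          (hg.isQuasiIso_iff hP hP' h0 h0' m).2 (ih m hm))
        ((filtIsQuasiIso_one_iff hP.1 hP'.1 n).2 (hψ n))

theorem operadHom_isQuasiIso (hP : P.IsConnected) (hP' : P'.IsConnected)
    (h0 : F.gen.IsConnected) (h0' : F'.gen.IsConnected) (hproj : F.gen.IsProjective)
    (hproj' : F'.gen.IsProjective) (h1 : (F.gen 1).IsGroundRing) (h1' : (F'.gen 1).IsGroundRing)
    (hψ : ψ.IsQuasiIso) (hψ' : ψ.indecomposablesMap.IsQuasiIso) : φ.IsQuasiIso := fun n => by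
  obtain ⟨g, hg⟩ := exists_liftsIndecomposablesMap ψ F F' hP' h0'
  have hg_isQuasiIso (m : ℕ) : (g m).IsQuasiIso := (hg.isQuasiIso_iff hP hP' h0 h0' m).2 (hψ' m)
  induction n using Nat.strong_induction_on with
  | _ n ih =>
    rcases Nat.lt_or_ge n 2 with hn | hn
    · exact φ.isQuasiIso_app_of_lt_two hP hP' hn
    have filt_two : FiltIsQuasiIso ψ F F' 2 n :=
      (shortExactOn_cone_indecomposables ψ F F' hP.1 hP'.1 n).acyclicOn_left
        ((filtIsQuasiIso_one_iff hP.1 hP'.1 n).2 (hψ n))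
        ((DGMod.Hom.isQuasiIso_iff_acyclicOn_cone _).1 (hψ' n))
    have filt_top : FiltIsQuasiIso ψ F F' n n :=
      hg.filtIsQuasiIso_of_le hP.1 hP'.1 h0 h0' hproj hproj' ih (fun m _ => hg_isQuasiIso m)
        filt_two hn le_rfl
    exact hg.isQuasiIso_app_of_filt hP.1 hP'.1 h0 h0' h1 h1' (hg_isQuasiIso 1) filt_top

end QuasiFree

end OperadicModules

theorem mainTheorem7 {K : Type u} [CommRing K] {P P' : Operad.{u, v} K}
    (hP : P.IsConnected) (hP' : P'.IsConnected) (φ : Operad.Hom P P')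
    {R : LeftModule P} {R' : LeftModule P'} (ψ : LeftModule.Hom R (R'.restrict φ))
    (F : QuasiFree R) (F' : QuasiFree R')
    (h0 : F.gen.IsConnected) (h0' : F'.gen.IsConnected)
    (hproj : F.gen.IsProjective) (hproj' : F'.gen.IsProjective) :
    (φ.IsQuasiIso → ψ.indecomposablesMap.IsQuasiIso → ψ.IsQuasiIso) ∧
    (φ.IsQuasiIso → ψ.IsQuasiIso → ψ.indecomposablesMap.IsQuasiIso) ∧
    ((F.gen 1).IsGroundRing → (F'.gen 1).IsGroundRing →
      ψ.IsQuasiIso → ψ.indecomposablesMap.IsQuasiIso → φ.IsQuasiIso) :=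
  ⟨QuasiFree.isQuasiIso_of_indecomposablesMap hP hP' h0 h0' hproj hproj',
    QuasiFree.indecomposablesMap_isQuasiIso hP hP' h0 h0' hproj hproj',
    QuasiFree.operadHom_isQuasiIso hP hP' h0 h0' hproj hproj'⟩
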